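/- Let $y_0\in H^1(0,1)$ with $y_0(0)=0$ and $y_1\in L^2(0,1)$. For a control $u$, let $y$ be the finite energy solution, in the class $C^0(H^1(0,1))\cap C^1(L^2(0,1))$, of $$\partial_{tt}y=\partial_{xx}y \ \text{ on } (0,1),\qquad y(t,0)=0,\quad \partial_x y(t,1)=u(t),\qquad y(0,\cdot)=y_0,\quad \partial_t y(0,\cdot)=y_1 .$$ For $\lambda\in[0,1]$ and $0<T\le\infty$ consider the problem $(\mathrm{OCP})_\lambda^T$ of minimizing $$J_\lambda^T(u)=\int_0^T\Big((1-\lambda)\,(\partial_x y(t,0))^2+\lambda\,u(t)^2\Big)\,dt$$ over all $u\in L^2(0,T)$; if $T<\infty$, under the constraint $y(T,\cdot)=\partial_t y(T,\cdot)=0$; if $T=\infty$, without terminal constraint. Put $$z_\lambda=\frac{-\lambda}{2-\lambda+2\sqrt{1-\lambda}} .$$ Let $T$ be a positive even integer. Then there is exactly one $\lambda\in[0,1]$ with $z_\lambda=\frac2T-1$; it satisfies $\lambda<1$, and $\lambda>0$ if and only if $T>2$. For this $\lambda$, the problems $(\mathrm{OCP})_1^T$ and $(\mathrm{OCP})_\lambda^\infty$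 have, for all initial data as above, unique optimal controls $u_1^T$ and $u_\lambda^\infty$ (unique up to equality almost everywhere), and $$u_1^T(t)=u_\lambda^\infty(t)\quad\text{for almost every } t\in(0,2),$$ $$\big\|u_1^T-u_\lambda^\infty\big\|_{L^2(2k,2k+2)}\le\Big|1-|z_\lambda|^k\Big|\,\frac2T\,\Big(\|y_0'\|_{L^2(0,1)}+\|y_1\|_{L^2(0,1)}\Big)\quad\text{for every } k\in\{0,1,\dots,(T-2)/2\},$$ where $|z_\lambda|^0=1$ also when $z_\lambda=0$. -/

import Mathlib

open MeasureTheory Set Filter Topology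
open scoped ENNReal ContDiff

noncomputable section

/-- Lebesgue measure on the space interval `(0,1)`. -/
def spaceMeasure : Measure ℝ := volume.restrict (Ioo (0 : ℝ) 1)

/-- The norm of `L²(a,b)`, with values in `[0,∞]`. -/
def L2norm (a b : ℝ) (f : ℝ → ℝ) : ℝ≥0∞ := eLpNorm f 2 (volume.restrict (Ioo a b))

/-- The admissible initial data: `y₀ ∈ H¹(0,1)` with `y₀(0) = 0`, and `y₁ ∈ L²(0,1)`.
An element of `H¹(0,1)` is given by its absolutely continuous representative on `[0,1]`,
whose (almost everywhere defined) derivative belongs to `L²(0,1)`. -/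
structure IsInitialData (y₀ y₁ : ℝ → ℝ) : Prop where
  absCont : AbsolutelyContinuousOnInterval y₀ 0 1
  deriv_memLp : MemLp (deriv y₀) 2 spaceMeasure
  zero_left : y₀ 0 = 0
  velocity_memLp : MemLp y₁ 2 spaceMeasure

/-- `t ↦ f t` is a continuous map from the time set `I` to `L²(0,1)`. -/
def ContinuousInL2 (I : Set ℝ) (f : ℝ → ℝ → ℝ) : Prop :=
  ∀ t ∈ I, MemLp (f t) 2 spaceMeasure ∧
    Tendsto (fun s => eLpNorm (fun x => f s x - f t x) 2 spaceMeasure) (𝓝[I] t) (𝓝 0)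

/-- `g t` is at every `t ∈ I` the derivative of `t ↦ f t` as a map from `I` to `L²(0,1)`
(one-sided at end points of `I` that belong to `I`). -/
def HasDerivInL2 (I : Set ℝ) (f g : ℝ → ℝ → ℝ) : Prop :=
  ∀ t ∈ I, Tendsto
    (fun s => eLpNorm (fun x => (s - t)⁻¹ * (f s x - f t x) - g t x) 2 spaceMeasure)
    (𝓝[I \ {t}] t) (𝓝 0)

/-- `y`, with time derivative `yt`, is the (weak, finite energy) solution on the time interval `I`
(`[0,T]` or `[0,∞)`) of
`∂ₜₜ y = ∂ₓₓ y` on `(0,1)`, `y(t,0) = 0`, `∂ₓ y(t,1) = u(t)`, `y(0,·) = y₀`, `∂ₜ y(0,·) = y₁`,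
in the class `C⁰(I; H¹(0,1)) ∩ C¹(I; L²(0,1))`. As for the initial data, `y t ∈ H¹(0,1)` is given
by its absolutely continuous representative on `[0,1]`; in particular `y t ∈ L²(0,1)`. Continuity
of `y` itself into `L²(0,1)` is part of `hasDeriv`. -/
structure IsSolution (I : Set ℝ) (y₀ y₁ u : ℝ → ℝ) (y yt : ℝ → ℝ → ℝ) : Prop where
  absCont : ∀ t ∈ I, AbsolutelyContinuousOnInterval (y t) 0 1
  deriv_continuous : ContinuousInL2 I (fun t => deriv (y t))
  velocity_continuous : ContinuousInL2 I yt
  hasDeriv : HasDerivInL2 I y yt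
  dirichlet : ∀ t ∈ I, y t 0 = 0
  init_position : ∀ x ∈ Icc (0 : ℝ) 1, y 0 x = y₀ x
  init_velocity : yt 0 =ᵐ[spaceMeasure] y₁
  /-- the wave equation and the Neumann condition at `x = 1`, tested with functions that vanish at
  the Dirichlet end, and integrated in time -/
  weak_form : ∀ w : ℝ → ℝ, ContDiff ℝ ∞ w → w 0 = 0 → ∀ t ∈ I,
    (∫ x, yt t x * w x ∂spaceMeasure) - (∫ x, yt 0 x * w x ∂spaceMeasure) =
      w 1 * (∫ s in (0 : ℝ)..t, u s)
        - ∫ s in (0 : ℝ)..t, ∫ x, deriv (y s) x * deriv w x ∂spaceMeasure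

/-- `v` is the trace `t ↦ ∂ₓ y(t,0)` on the time interval `I` of a finite energy solution `y` of the
wave equation: the locally integrable function for which Green's formula holds with all test
functions that vanish at `x = 1` (but not necessarily at `x = 0`). -/
structure IsLeftFlux (I : Set ℝ) (y yt : ℝ → ℝ → ℝ) (v : ℝ → ℝ) : Prop where
  integrable : ∀ t ∈ I, IntervalIntegrable v volume 0 t
  green : ∀ w : ℝ → ℝ, ContDiff ℝ ∞ w → w 1 = 0 → ∀ t ∈ I,
    (∫ x, yt t x * w x ∂spaceMeasure) - (∫ x, yt 0 x * w x ∂spaceMeasure) =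
      - w 0 * (∫ s in (0 : ℝ)..t, v s)
        - ∫ s in (0 : ℝ)..t, ∫ x, deriv (y s) x * deriv w x ∂spaceMeasure

/-- The objective functional `∫_I ((1-λ) (∂ₓ y(t,0))² + λ u(t)²) dt ∈ [0,∞]`, for `λ ∈ [0,1]`,
in terms of the trace `v = ∂ₓ y(·,0)` and of the control `u`. -/
def cost (lam : ℝ) (I : Set ℝ) (v u : ℝ → ℝ) : ℝ≥0∞ :=
  ∫⁻ t in I, ENNReal.ofReal ((1 - lam) * v t ^ 2 + lam * u t ^ 2)

/-- Feasibility for the problem with finite horizon `T`: `u ∈ L²(0,T)` steers `(y₀,y₁)` to rest at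
time `T`; `v` is the trace at `x = 0` of the space derivative of the state that `u` generates. -/
def IsFeasible (T : ℝ) (y₀ y₁ u v : ℝ → ℝ) : Prop :=
  MemLp u 2 (volume.restrict (Ioo 0 T)) ∧
    ∃ y yt : ℝ → ℝ → ℝ, IsSolution (Icc 0 T) y₀ y₁ u y yt ∧ IsLeftFlux (Icc 0 T) y yt v ∧
      (∀ x ∈ Icc (0 : ℝ) 1, y T x = 0) ∧ yt T =ᵐ[spaceMeasure] 0

/-- Feasibility for the problem with infinite horizon: `u ∈ L²(0,∞)`, without terminal
constraint. -/
def IsFeasibleInfinite (y₀ y₁ u v : ℝ → ℝ) : Prop :=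
  MemLp u 2 (volume.restrict (Ioi 0)) ∧
    ∃ y yt : ℝ → ℝ → ℝ, IsSolution (Ici 0) y₀ y₁ u y yt ∧ IsLeftFlux (Ici 0) y yt v

/-- `u` is an optimal control of the problem with weight `lam` and finite horizon `T`. -/
def IsOptimalControl (lam T : ℝ) (y₀ y₁ u : ℝ → ℝ) : Prop :=
  ∃ v, IsFeasible T y₀ y₁ u v ∧
    ∀ u' v', IsFeasible T y₀ y₁ u' v' → cost lam (Icc 0 T) v u ≤ cost lam (Icc 0 T) v' u'

/-- `u` is an optimal control of the problem with weight `lam` and infinite horizon. -/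
def IsOptimalControlInfinite (lam : ℝ) (y₀ y₁ u : ℝ → ℝ) : Prop :=
  ∃ v, IsFeasibleInfinite y₀ y₁ u v ∧
    ∀ u' v', IsFeasibleInfinite y₀ y₁ u' v' → cost lam (Ici 0) v u ≤ cost lam (Ici 0) v' u'

/-- The number `z_λ = -λ / (2 - λ + 2 √(1-λ))`, for `λ ∈ [0,1]`. -/
def zParam (lam : ℝ) : ℝ := -lam / (2 - lam + 2 * Real.sqrt (1 - lam))

end

/-! D'Alembert's formula reduces the problem to a scalar recursion. A finite energy wave with
`y(t,0) = 0` has `∂ₓ y = p(t+x) + p(t-x)` and `∂ₜ y = p(t+x) - p(t-x)` for one profile `p` on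
`(-1,∞)`. The data fix `p` on `(-1,1)` as `p₀`, the Neumann condition reads `u(t) = p(t+1) +
p(t-1)`, the flux at `0` is `2 p(t)`, and rest at time `T` means `p = 0` on `(T-1,T+1)`. Existence
for given `p` is a computation in `L²` (`wave_isSolution`); that every solution arises this way
rests on uniqueness (`IsSolution.unique`), an energy argument.

Cut time into blocks of length 2, with `T = 2n`. The minimal norm control to rest keeps the same
size on each block and alternates in sign, `(-1)^k p₀ / n`. Its scalar product with every feasible
control is the same, by telescoping, so Pythagoras gives optimality and uniqueness
(`IsFeasible.integral_sq`).

For the infinite horizon, completing the square (`IsStableMultiplier.stageCost_eq`) writes the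
running cost as the decrease of the value `λ(1+z) p²` plus a positive multiple of `(p(t+1) - z
p(t-1))²`. As `λ < 1`, finite cost makes `p` square integrable, so the value left at time `R` tends
to `0`. Hence exactly the feedback `p(t+1) = z p(t-1)` is optimal, and the control on block `k` is
`(1+z) z^k p₀`.

The condition `z = 2/T - 1` says `1 + z = 1/n`, so both controls start as `p₀ / n`. Since `z ≤ 0`
their signs alternate alike and they differ on block `k` by `(-1)^k (1 - |z|^k) p₀ / n`; finally
`‖p₀‖ ≤ ‖y₀'‖ + ‖y₁‖`. -/

/-! ### Translations and averages in `L²` -/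

theorem tendsto_eLpNorm_translate_sub {p : ℝ → ℝ} (hp : MemLp p 2 volume) :
    Tendsto (fun a => eLpNorm (fun x => p (a + x) - p x) 2 volume) (𝓝 0) (𝓝 0) := by
  have hmp : ∀ a : ℝ, MeasurePreserving (ContinuousMap.mk (fun x : ℝ => a + x) (by fun_prop))
      volume volume := fun a => measurePreserving_add_left volume a
  have hg : Tendsto (fun a : ℝ => ContinuousMap.mk (fun x : ℝ => a + x) (by fun_prop)) (𝓝 0)
      (𝓝 (ContinuousMap.mk (fun x : ℝ => 0 + x) (by fun_prop))) :=
    (ContinuousMap.curry (ContinuousMap.mk (fun q : ℝ × ℝ => q.1 + q.2)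
      (by fun_prop))).continuous.tendsto 0
  -- Composition with measure preserving maps is continuous on `L²` when the maps converge in the
  -- compact-open topology, as translations do.
  have h := Filter.Tendsto.compMeasurePreservingLp (p := 2)
    (tendsto_const_nhds (x := hp.toLp p)) hg hmp (hmp 0) (by simp)
  rw [Lp.tendsto_Lp_iff_tendsto_eLpNorm'] at h
  refine h.congr fun a => eLpNorm_congr_ae ?_
  have h1 : ∀ a : ℝ, Lp.compMeasurePreserving _ (hmp a) (hp.toLp p) =ᵐ[volume]
      fun x => p (a + x) := fun a =>
    (Lp.coeFn_compMeasurePreserving _ (hmp a)).trans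
      ((hmp a).quasiMeasurePreserving.ae_eq_comp hp.coeFn_toLp)
  filter_upwards [h1 a, h1 0] with x hx hx0
  rw [Pi.sub_apply, hx, hx0]
  simp only [zero_add]

theorem eLpNorm_two_sq {α : Type*} [MeasurableSpace α] (μ : Measure α) (f : α → ℝ) :
    eLpNorm f 2 μ ^ 2 = ∫⁻ x, ‖f x‖ₑ ^ 2 ∂μ := by
  have := eLpNorm_nnreal_pow_eq_lintegral (p := 2) (f := f) (μ := μ) (by norm_num)
  simpa using this

/-- The average of a family of functions bounded in `L²` satisfies the same bound. -/
theorem eLpNorm_integral_le {α β : Type*} [MeasurableSpace α] [MeasurableSpace β]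
    {ν : Measure α} [IsProbabilityMeasure ν] {μ : Measure β} [SFinite μ] {G : α → β → ℝ}
    (hG : Measurable (Function.uncurry G)) {ε : ℝ≥0∞}
    (h : ∀ᵐ a ∂ν, eLpNorm (G a) 2 μ ≤ ε) :
    eLpNorm (fun x => ∫ a, G a x ∂ν) 2 μ ≤ ε := by
  have key : eLpNorm (fun x => ∫ a, G a x ∂ν) 2 μ ^ 2 ≤ ε ^ 2 := by
    rw [eLpNorm_two_sq]
    calc ∫⁻ x, ‖∫ a, G a x ∂ν‖ₑ ^ 2 ∂μ ≤ ∫⁻ x, ∫⁻ a, ‖G a x‖ₑ ^ 2 ∂ν ∂μ := by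
          refine lintegral_mono fun x => ?_
          have hx : Measurable fun a => G a x := hG.of_uncurry_right
          rw [← eLpNorm_two_sq]
          gcongr
          -- On a probability space the `L¹` norm is at most the `L²` norm, which brings the square
          -- inside the average before Tonelli.
          refine (enorm_integral_le_lintegral_enorm _).trans ?_
          rw [← eLpNorm_one_eq_lintegral_enorm]
          exact eLpNorm_le_eLpNorm_of_exponent_le (by norm_num) hx.aestronglyMeasurable
      _ = ∫⁻ a, ∫⁻ x, ‖G a x‖ₑ ^ 2 ∂μ ∂ν := by
          refine lintegral_lintegral_swap ?_
          have : Measurable fun q : β × α => ‖G q.2 q.1‖ₑ ^ 2 :=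
            ((hG.comp measurable_swap).enorm).pow_const 2
          exact this.aemeasurable
      _ ≤ ∫⁻ _, ε ^ 2 ∂ν := by
          refine lintegral_mono_ae ?_
          filter_upwards [h] with a ha
          rw [← eLpNorm_two_sq]
          gcongr
      _ = ε ^ 2 := by simp
  exact (ENNReal.pow_le_pow_left_iff (by norm_num)).1 key

/-! ### Profiles and the regularity of d'Alembert waves -/

/-- A measurable profile that is square integrable on every left half-line. -/
structure IsProfile (p : ℝ → ℝ) : Prop where
  measurable : Measurable p
  memLp : ∀ R : ℝ, MemLp p 2 (volume.restrict (Iio R))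

namespace IsProfile

variable {p : ℝ → ℝ}

theorem memLp_of_subset (hp : IsProfile p) {s : Set ℝ} {R : ℝ} (hs : s ⊆ Iio R) :
    MemLp p 2 (volume.restrict s) :=
  (hp.memLp R).mono_measure (Measure.restrict_mono hs le_rfl)

theorem intervalIntegrable (hp : IsProfile p) (a b : ℝ) : IntervalIntegrable p volume a b := by
  rw [intervalIntegrable_iff]
  have h : uIoc a b ⊆ Iio (max a b + 1) := fun x hx => by
    have := hx.2
    simp only [mem_Iio]
    linarith
  have h2 := hp.memLp_of_subset h
  have : IsFiniteMeasure (volume.restrict (uIoc a b)) := ⟨by simp [uIoc]⟩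
  exact h2.integrable (by norm_num)

theorem intervalIntegrable_add (hp : IsProfile p) (t a b : ℝ) :
    IntervalIntegrable (fun x => p (t + x)) volume a b := by
  simpa using (hp.intervalIntegrable (t + a) (t + b)).comp_add_left t

theorem intervalIntegrable_sub (hp : IsProfile p) (t a b : ℝ) :
    IntervalIntegrable (fun x => p (t - x)) volume a b := by
  simpa using (hp.intervalIntegrable (t - a) (t - b)).comp_sub_left t

theorem indicator (hp : IsProfile p) (R : ℝ) : IsProfile ((Iio R).indicator p) :=
  ⟨hp.measurable.indicator measurableSet_Iio, fun S => (hp.memLp S).indicator measurableSet_Iio⟩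

theorem memLp_indicator (hp : IsProfile p) (R : ℝ) : MemLp ((Iio R).indicator p) 2 volume :=
  (memLp_indicator_iff_restrict measurableSet_Iio).2 (hp.memLp R)

end IsProfile

/-- The displacement of the wave with profile `p`: `∂ₓ y(t,x) = p (t + x) + p (t - x)`. -/
noncomputable def wavePos (p : ℝ → ℝ) (t x : ℝ) : ℝ := ∫ r in (0 : ℝ)..x, (p (t + r) + p (t - r))

/-- The velocity of the wave with profile `p`. -/
noncomputable def waveVel (p : ℝ → ℝ) (t x : ℝ) : ℝ := p (t + x) - p (t - x)

instance : IsProbabilityMeasure spaceMeasure := ⟨by simp [spaceMeasure]⟩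

theorem integral_spaceMeasure (f : ℝ → ℝ) : ∫ x, f x ∂spaceMeasure = ∫ x in (0 : ℝ)..1, f x := by
  rw [intervalIntegral.integral_of_le zero_le_one, integral_Ioc_eq_integral_Ioo, spaceMeasure]

theorem ae_spaceMeasure_iff {P : ℝ → Prop} :
    (∀ᵐ x ∂spaceMeasure, P x) ↔ ∀ᵐ x, x ∈ Ioo (0 : ℝ) 1 → P x :=
  ae_restrict_iff' measurableSet_Ioo

theorem spaceMeasure_le : spaceMeasure ≤ volume := Measure.restrict_le_self

section Wave

variable {p : ℝ → ℝ}

theorem wavePos_absolutelyContinuous (hp : IsProfile p) (t : ℝ) :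
    AbsolutelyContinuousOnInterval (wavePos p t) 0 1 :=
  ((hp.intervalIntegrable_add t 0 1).add
    (hp.intervalIntegrable_sub t 0 1)).absolutelyContinuousOnInterval_intervalIntegral (by simp)

theorem deriv_wavePos (hp : IsProfile p) (t : ℝ) :
    deriv (wavePos p t) =ᵐ[spaceMeasure] fun x => p (t + x) + p (t - x) := by
  rw [EventuallyEq, ae_spaceMeasure_iff]
  filter_upwards [((hp.intervalIntegrable_add t 0 1).add
    (hp.intervalIntegrable_sub t 0 1)).ae_hasDerivAt_integral] with x hx hx2
  exact (hx (by simpa using Ioo_subset_Icc_self hx2) 0 (by simp)).deriv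

/-- In this form time enters only through the end points, so increments in time become integrals
over short intervals. -/
theorem wavePos_eq (hp : IsProfile p) (t x : ℝ) : wavePos p t x = ∫ r in (t - x)..(t + x), p r := by
  unfold wavePos
  rw [intervalIntegral.integral_add (hp.intervalIntegrable_add t 0 x)
    (hp.intervalIntegrable_sub t 0 x), intervalIntegral.integral_comp_add_left,
    intervalIntegral.integral_comp_sub_left]
  simp only [add_zero, sub_zero]
  rw [add_comm, intervalIntegral.integral_add_adjacent_intervals] <;>
    exact hp.intervalIntegrable _ _

/-- The increment is `h` times an average of velocities at intermediate times. Differentiability in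
time thus follows from continuity of translations and `eLpNorm_integral_le`. -/
theorem wavePos_sub (hp : IsProfile p) (t h x : ℝ) :
    wavePos p (t + h) x - wavePos p t x =
      h * ∫ θ in (0 : ℝ)..1, (p (t + θ * h + x) - p (t + θ * h - x)) := by
  have e (c : ℝ) : IntervalIntegrable (fun θ => p (c + θ * h)) volume 0 1 := by
    rcases eq_or_ne h 0 with rfl | hh
    · simp
    · have := (hp.intervalIntegrable_add c 0 h).comp_mul_left (c := h)
      simpa [hh, mul_comm] using this
  have i (c : ℝ) : h * ∫ θ in (0 : ℝ)..1, p (c + θ * h) = ∫ r in c..(c + h), p r := by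
    simp [mul_comm]
  have hi := hp.intervalIntegrable
  rw [wavePos_eq hp, wavePos_eq hp]
  have e1 : ∀ θ : ℝ, t + θ * h + x = (t + x) + θ * h := fun θ => by ring
  have e2 : ∀ θ : ℝ, t + θ * h - x = (t - x) + θ * h := fun θ => by ring
  simp only [e1, e2]
  rw [intervalIntegral.integral_sub (e _) (e _), mul_sub, i, i,
    intervalIntegral.integral_interval_sub_interval_comm (hi _ _) (hi _ _) (hi _ _),
    intervalIntegral.integral_symm (t - x) (t + h - x),
    intervalIntegral.integral_symm (t + x) (t + h + x)]
  have e3 : t + h - x = t - x + h := by ring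
  have e4 : t + h + x = t + x + h := by ring
  rw [e3, e4]
  ring

theorem eLpNorm_comp_add_sub {f : ℝ → ℝ} (hf : Measurable f) (t : ℝ) :
    eLpNorm (fun x => f (t + x)) 2 spaceMeasure ≤ eLpNorm f 2 volume ∧
      eLpNorm (fun x => f (t - x)) 2 spaceMeasure ≤ eLpNorm f 2 volume := by
  constructor
  · refine (eLpNorm_mono_measure _ spaceMeasure_le).trans_eq ?_
    exact eLpNorm_comp_measurePreserving hf.aestronglyMeasurable (measurePreserving_add_left volume t)
  · refine (eLpNorm_mono_measure _ spaceMeasure_le).trans_eq ?_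
    exact eLpNorm_comp_measurePreserving hf.aestronglyMeasurable
      (Measure.measurePreserving_sub_left volume t)

theorem eLpNorm_even_odd_le {f : ℝ → ℝ} (hf : Measurable f) (t : ℝ) :
    eLpNorm (fun x => f (t + x) + f (t - x)) 2 spaceMeasure ≤ 2 * eLpNorm f 2 volume ∧
      eLpNorm (fun x => f (t + x) - f (t - x)) 2 spaceMeasure ≤ 2 * eLpNorm f 2 volume := by
  obtain ⟨h1, h2⟩ := eLpNorm_comp_add_sub hf t
  have m1 : AEStronglyMeasurable (fun x => f (t + x)) spaceMeasure :=
    (hf.comp (by fun_prop)).aestronglyMeasurable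
  have m2 : AEStronglyMeasurable (fun x => f (t - x)) spaceMeasure :=
    (hf.comp (by fun_prop)).aestronglyMeasurable
  rw [two_mul]
  exact ⟨(eLpNorm_add_le m1 m2 (by norm_num)).trans (add_le_add h1 h2),
    (eLpNorm_sub_le m1 m2 (by norm_num)).trans (add_le_add h1 h2)⟩

theorem memLp_comp_add_sub {f : ℝ → ℝ} (hf : MemLp f 2 volume) (t : ℝ) :
    MemLp (fun x => f (t + x)) 2 spaceMeasure ∧ MemLp (fun x => f (t - x)) 2 spaceMeasure :=
  ⟨(hf.comp_measurePreserving (measurePreserving_add_left volume t)).mono_measure spaceMeasure_le,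
    (hf.comp_measurePreserving (Measure.measurePreserving_sub_left volume t)).mono_measure
      spaceMeasure_le⟩

/-- Up to time `t + 1` the wave sees `p` only below `t + 2`. Truncating there gives a globally
square integrable profile with the same wave near time `t`, to which continuity of translations
applies. -/
theorem IsProfile.exists_global (hp : IsProfile p) (t : ℝ) :
    ∃ q : ℝ → ℝ, IsProfile q ∧ MemLp q 2 volume ∧ ∀ s < t + 1, ∀ x ∈ Icc (0 : ℝ) 1,
      q (s + x) = p (s + x) ∧ q (s - x) = p (s - x) ∧ wavePos q s x = wavePos p s x := by
  have key : ∀ s < t + 1, ∀ x ∈ Icc (0 : ℝ) 1,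
      (Iio (t + 2)).indicator p (s + x) = p (s + x) ∧
        (Iio (t + 2)).indicator p (s - x) = p (s - x) := fun s hs x hx => by
    have := hx.1
    have := hx.2
    constructor <;> refine indicator_of_mem ?_ _ <;> simp only [mem_Iio] <;> linarith
  refine ⟨_, hp.indicator (t + 2), hp.memLp_indicator (t + 2), fun s hs x hx =>
    ⟨(key s hs x hx).1, (key s hs x hx).2, ?_⟩⟩
  refine intervalIntegral.integral_congr fun r hr => ?_
  rw [uIcc_of_le hx.1] at hr
  obtain ⟨h1, h2⟩ := key s hs r ⟨hr.1, hr.2.trans hx.2⟩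
  simp only [h1, h2]

theorem IsProfile.memLp_comp (hp : IsProfile p) (t : ℝ) :
    MemLp (fun x => p (t + x)) 2 spaceMeasure ∧ MemLp (fun x => p (t - x)) 2 spaceMeasure := by
  obtain ⟨q, -, hq, h⟩ := hp.exists_global t
  obtain ⟨h1, h2⟩ := memLp_comp_add_sub hq t
  constructor
  · refine h1.ae_eq ?_
    rw [EventuallyEq, ae_spaceMeasure_iff]
    exact ae_of_all _ fun x hx => (h t (by linarith) x (Ioo_subset_Icc_self hx)).1
  · refine h2.ae_eq ?_
    rw [EventuallyEq, ae_spaceMeasure_iff]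
    exact ae_of_all _ fun x hx => (h t (by linarith) x (Ioo_subset_Icc_self hx)).2.1

theorem IsProfile.memLp_waveVel (hp : IsProfile p) (t : ℝ) :
    MemLp (waveVel p t) 2 spaceMeasure :=
  (hp.memLp_comp t).1.sub (hp.memLp_comp t).2

theorem IsProfile.memLp_deriv_wavePos (hp : IsProfile p) (t : ℝ) :
    MemLp (deriv (wavePos p t)) 2 spaceMeasure :=
  ((hp.memLp_comp t).1.add (hp.memLp_comp t).2).ae_eq (deriv_wavePos hp t).symm

theorem tendsto_translate_at {q : ℝ → ℝ} (hq : MemLp q 2 volume) (t : ℝ) :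
    Tendsto (fun s => 2 * eLpNorm (fun x => q (s - t + x) - q x) 2 volume) (𝓝 t) (𝓝 0) := by
  have h1 : Tendsto (fun s : ℝ => s - t) (𝓝 t) (𝓝 0) := by
    have : Continuous fun s : ℝ => s - t := by fun_prop
    simpa using this.tendsto t
  have := ENNReal.Tendsto.const_mul ((tendsto_eLpNorm_translate_sub hq).comp h1)
    (Or.inr (show (2 : ℝ≥0∞) ≠ ⊤ by simp))
  simpa using this

theorem waveVel_continuousInL2 (hp : IsProfile p) (I : Set ℝ) : ContinuousInL2 I (waveVel p) := by
  refine fun t _ => ⟨hp.memLp_waveVel t, ?_⟩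
  obtain ⟨q, hq1, hq2, hq⟩ := hp.exists_global t
  refine tendsto_of_tendsto_of_tendsto_of_le_of_le' tendsto_const_nhds
    ((tendsto_translate_at hq2 t).mono_left nhdsWithin_le_nhds) (Eventually.of_forall fun _ =>
      zero_le) ?_
  filter_upwards [mem_nhdsWithin_of_mem_nhds (Iio_mem_nhds (show t < t + 1 by linarith))] with s hs
  have m : Measurable fun x => q (s - t + x) - q x :=
    (hq1.measurable.comp (by fun_prop)).sub hq1.measurable
  -- The increment of the velocity is `f(t+x) - f(t-x)`, where `f` is a translate of `q` minus `q`.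
  refine le_trans (le_of_eq ?_) (eLpNorm_even_odd_le m t).2
  refine eLpNorm_congr_ae ?_
  rw [EventuallyEq, ae_spaceMeasure_iff]
  refine ae_of_all _ fun x hx => ?_
  obtain ⟨h1, h2, -⟩ := hq s hs x (Ioo_subset_Icc_self hx)
  obtain ⟨h3, h4, -⟩ := hq t (by linarith) x (Ioo_subset_Icc_self hx)
  have e1 : s - t + (t + x) = s + x := by ring
  have e2 : s - t + (t - x) = s - x := by ring
  simp only [waveVel, ← h1, ← h2, ← h3, ← h4, e1, e2]
  ring

theorem deriv_wavePos_continuousInL2 (hp : IsProfile p) (I : Set ℝ) :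
    ContinuousInL2 I (fun t => deriv (wavePos p t)) := by
  refine fun t _ => ⟨hp.memLp_deriv_wavePos t, ?_⟩
  obtain ⟨q, hq1, hq2, hq⟩ := hp.exists_global t
  refine tendsto_of_tendsto_of_tendsto_of_le_of_le' tendsto_const_nhds
    ((tendsto_translate_at hq2 t).mono_left nhdsWithin_le_nhds) (Eventually.of_forall fun _ =>
      zero_le) ?_
  filter_upwards [mem_nhdsWithin_of_mem_nhds (Iio_mem_nhds (show t < t + 1 by linarith))] with s hs
  have m : Measurable fun x => q (s - t + x) - q x :=
    (hq1.measurable.comp (by fun_prop)).sub hq1.measurable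
  refine le_trans (le_of_eq ?_) (eLpNorm_even_odd_le m t).1
  refine eLpNorm_congr_ae ?_
  have hs2 := deriv_wavePos hp s
  have ht2 := deriv_wavePos hp t
  rw [EventuallyEq, ae_spaceMeasure_iff] at hs2 ht2 ⊢
  filter_upwards [hs2, ht2] with x hs2 ht2 hx
  obtain ⟨h1, h2, -⟩ := hq s hs x (Ioo_subset_Icc_self hx)
  obtain ⟨h3, h4, -⟩ := hq t (by linarith) x (Ioo_subset_Icc_self hx)
  have e1 : s - t + (t + x) = s + x := by ring
  have e2 : s - t + (t - x) = s - x := by ring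
  rw [hs2 hx, ht2 hx]
  simp only [← h1, ← h2, ← h3, ← h4, e1, e2]
  ring

theorem wavePos_hasDerivInL2 (hp : IsProfile p) (I : Set ℝ) :
    HasDerivInL2 I (wavePos p) (waveVel p) := by
  intro t _
  obtain ⟨q, hq1, hq2, hq⟩ := hp.exists_global t
  rw [ENNReal.tendsto_nhds_zero]
  intro ε hε
  have hN := (ENNReal.tendsto_nhds_zero.1 (tendsto_translate_at hq2 t)) ε hε
  obtain ⟨δ, hδ, hδN⟩ := Metric.eventually_nhds_iff.1 hN
  have hnear : ∀ᶠ s in 𝓝[I \ {t}] t, dist s t < min δ 1 :=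
    mem_nhdsWithin_of_mem_nhds (Metric.ball_mem_nhds t (by positivity))
  have hne : ∀ᶠ s in 𝓝[I \ {t}] t, s ≠ t := by
    filter_upwards [self_mem_nhdsWithin] with s hs using hs.2
  filter_upwards [hnear, hne] with s hs hst
  have hst1 : s < t + 1 := by
    have := hs.trans_le (min_le_right _ _)
    rw [Real.dist_eq] at this
    linarith [le_abs_self (s - t)]
  have hh : s - t ≠ 0 := sub_ne_zero.2 hst
  -- `G θ` is the velocity at time `t + θ(s-t)` minus the velocity at time `t`; its average over `θ`
  -- is the error of the difference quotient.
  let f : ℝ → ℝ → ℝ := fun θ y => q (t + θ * (s - t) - t + y) - q y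
  let G : ℝ → ℝ → ℝ := fun θ x => f θ (t + x) - f θ (t - x)
  have hGm : Measurable (Function.uncurry G) := by
    have := hq1.measurable
    unfold Function.uncurry
    fun_prop
  let ν : Measure ℝ := volume.restrict (Ioc 0 1)
  have : IsProbabilityMeasure ν := ⟨by simp [ν]⟩
  have hb : ∀ᵐ θ ∂ν, eLpNorm (G θ) 2 spaceMeasure ≤ ε := by
    refine (ae_restrict_iff' measurableSet_Ioc).2 (ae_of_all _ fun θ hθ => ?_)
    have m : Measurable (f θ) := (hq1.measurable.comp (by fun_prop)).sub hq1.measurable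
    refine (eLpNorm_even_odd_le m t).2.trans (hδN ?_)
    refine lt_of_le_of_lt ?_ (hs.trans_le (min_le_left _ _))
    rw [Real.dist_eq, Real.dist_eq, add_sub_cancel_left, abs_mul, abs_of_pos hθ.1]
    exact mul_le_of_le_one_left (abs_nonneg _) hθ.2
  refine le_trans (le_of_eq ?_) (eLpNorm_integral_le hGm hb)
  refine eLpNorm_congr_ae ?_
  rw [EventuallyEq, ae_spaceMeasure_iff]
  refine ae_of_all _ fun x hx => ?_
  have hx' := Ioo_subset_Icc_self hx
  obtain ⟨-, -, h1⟩ := hq s hst1 x hx'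
  obtain ⟨h3, h4, h2⟩ := hq t (by linarith) x hx'
  have hts : t + (s - t) = s := by ring
  have hsub := wavePos_sub hq1 t (s - t) x
  rw [hts] at hsub
  have e (c : ℝ) : IntervalIntegrable (fun θ => q (c + θ * (s - t))) volume 0 1 := by
    have := (hq1.intervalIntegrable_add c 0 (s - t)).comp_mul_left (c := s - t)
    simpa [hh, mul_comm] using this
  have hG : ∀ θ, G θ x = (q (t + x + θ * (s - t)) - q (t - x + θ * (s - t))) - waveVel q t x := by
    intro θ
    simp only [G, f, waveVel]
    rw [show t + θ * (s - t) - t + (t + x) = t + x + θ * (s - t) by ring,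
      show t + θ * (s - t) - t + (t - x) = t - x + θ * (s - t) by ring]
    ring
  have hI : ∫ θ, G θ x ∂ν = (∫ θ in (0 : ℝ)..1, (q (t + θ * (s - t) + x) - q (t + θ * (s - t) - x)))
      - waveVel q t x := by
    have e1 : ∀ θ : ℝ, t + θ * (s - t) + x = t + x + θ * (s - t) := fun θ => by ring
    have e2 : ∀ θ : ℝ, t + θ * (s - t) - x = t - x + θ * (s - t) := fun θ => by ring
    simp only [e1, e2, hG]
    rw [show ∫ θ, (q (t + x + θ * (s - t)) - q (t - x + θ * (s - t))) - waveVel q t x ∂ν =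
      ∫ θ in (0 : ℝ)..1, ((q (t + x + θ * (s - t)) - q (t - x + θ * (s - t))) - waveVel q t x) from
      (intervalIntegral.integral_of_le zero_le_one).symm,
      intervalIntegral.integral_sub ((e _).sub (e _)) (by simp)]
    simp
  rw [hI, ← h1, ← h2, hsub, inv_mul_cancel_left₀ hh]
  simp only [waveVel, h3, h4]

end Wave

/-! ### Green's formula for d'Alembert waves -/

section Green

variable {p : ℝ → ℝ}

/-- The shear `(x,s) ↦ (x,x+s)` preserves measure, so the integrand is the pull-back of a product of
two integrable functions. This justifies Fubini below. -/
theorem IsProfile.integrableOn_prod (hp : IsProfile p) {g : ℝ → ℝ} (hg : Continuous g) (t : ℝ) :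
    IntegrableOn (Function.uncurry fun x s => p (s + x) * g x) (uIoc 0 1 ×ˢ uIoc 0 t) := by
  let q := (Icc (min 0 t) (max 0 t + 1)).indicator p
  have hle : min 0 t ≤ max 0 t + 1 := (min_le_left _ _).trans (by linarith [le_max_left 0 t])
  have hq : Integrable q := by
    rw [integrable_indicator_iff measurableSet_Icc, integrableOn_Icc_iff_integrableOn_Ioc]
    exact (intervalIntegrable_iff_integrableOn_Ioc_of_le hle).1 (hp.intervalIntegrable _ _)
  let k := (Icc (0 : ℝ) 1).indicator g
  have hk : Integrable k := by
    rw [integrable_indicator_iff measurableSet_Icc]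
    exact hg.integrableOn_Icc
  have h := (measurePreserving_prod_add (volume : Measure ℝ) (volume : Measure ℝ)).integrable_comp
    (hk.mul_prod hq).aestronglyMeasurable |>.2 (hk.mul_prod hq)
  refine (h.integrableOn (s := uIoc 0 1 ×ˢ uIoc 0 t)).congr_fun ?_
    (measurableSet_uIoc.prod measurableSet_uIoc)
  rintro ⟨x, s⟩ ⟨hx, hs⟩
  simp only [uIoc_of_le zero_le_one, mem_Ioc] at hx
  simp only [uIoc, mem_Ioc] at hs
  have h1 : k x = g x :=
    indicator_of_mem (show x ∈ Icc (0 : ℝ) 1 from ⟨hx.1.le, hx.2⟩) _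
  have h2 : q (x + s) = p (s + x) := by
    rw [add_comm]
    refine indicator_of_mem (show s + x ∈ Icc (min 0 t) (max 0 t + 1) from ⟨?_, ?_⟩) _ <;> linarith
  simp only [Function.comp_apply, Function.uncurry, h1, h2, mul_comm]

/-- This is the weak form of the transport equation `∂ₛ = ∂ₓ` for `p(s+x)`. As `p` is only square
integrable, the integration by parts is done on its primitive in `x`. -/
theorem IsProfile.green_add (hp : IsProfile p) {w : ℝ → ℝ} (hw : ContDiff ℝ ∞ w) (t : ℝ) :
    (∫ x in (0 : ℝ)..1, p (t + x) * w x) - (∫ x in (0 : ℝ)..1, p (0 + x) * w x) =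
      w 1 * (∫ s in (0 : ℝ)..t, p (s + 1)) - w 0 * (∫ s in (0 : ℝ)..t, p s)
        - ∫ s in (0 : ℝ)..t, ∫ x in (0 : ℝ)..1, p (s + x) * deriv w x := by
  have hw' : Continuous (deriv w) := hw.continuous_deriv (by simp)
  have hi := hp.intervalIntegrable
  let Φ : ℝ → ℝ → ℝ := fun t x => ∫ r in (0 : ℝ)..x, p (t + r)
  have hΦ (t : ℝ) : AbsolutelyContinuousOnInterval (Φ t) 0 1 :=
    (hp.intervalIntegrable_add t 0 1).absolutelyContinuousOnInterval_intervalIntegral (by simp)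
  have hw1 : AbsolutelyContinuousOnInterval w 0 1 :=
    (hw.of_le (by simp)).contDiffOn.absolutelyContinuousOnInterval
  have hparts (t : ℝ) : ∫ x in (0 : ℝ)..1, p (t + x) * w x =
      Φ t 1 * w 1 - ∫ x in (0 : ℝ)..1, Φ t x * deriv w x := by
    rw [(hΦ t).integral_mul_deriv_eq_deriv_mul hw1]
    have : ∫ x in (0 : ℝ)..1, p (t + x) * w x = ∫ x in (0 : ℝ)..1, deriv (Φ t) x * w x := by
      refine intervalIntegral.integral_congr_ae ?_
      filter_upwards [(hp.intervalIntegrable_add t 0 1).ae_hasDerivAt_integral] with x hx hx2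
      rw [(hx (uIoc_subset_uIcc hx2) 0 (by simp)).deriv]
    rw [this]
    simp [Φ]
  -- The transport equation integrated in both variables: `Φ t x` is the integral of `p` over
  -- `[t,t+x]`, and the other terms are integrals over `[0,x]`, `[x,t+x]` and `[0,t]`.
  have hΦsub (x : ℝ) : Φ t x = Φ 0 x + (∫ s in (0 : ℝ)..t, p (s + x)) - ∫ s in (0 : ℝ)..t, p s := by
    simp only [Φ, intervalIntegral.integral_comp_add_left, intervalIntegral.integral_comp_add_right,
      add_zero, zero_add]
    have h1 := intervalIntegral.integral_add_adjacent_intervals (hi 0 t) (hi t (t + x))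
    have h2 := intervalIntegral.integral_add_adjacent_intervals (hi 0 x) (hi x (t + x))
    linarith
  have hcont (t : ℝ) : IntervalIntegrable (fun x => Φ t x * deriv w x) volume 0 1 :=
    ((hΦ t).continuousOn.mul hw'.continuousOn).intervalIntegrable
  have hfub := intervalIntegral_intervalIntegral_swap (hp.integrableOn_prod hw' t)
  have hftc : ∫ x in (0 : ℝ)..1, deriv w x = w 1 - w 0 :=
    hw1.integral_deriv_eq_sub
  have hmid : IntervalIntegrable (fun x => ∫ s in (0 : ℝ)..t, p (s + x) * deriv w x) volume 0 1 := by
    have : (fun x => ∫ s in (0 : ℝ)..t, p (s + x) * deriv w x) = fun x =>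
        Φ t x * deriv w x - Φ 0 x * deriv w x + (∫ s in (0 : ℝ)..t, p s) * deriv w x := by
      funext x
      rw [intervalIntegral.integral_mul_const, hΦsub x]
      ring
    rw [this]
    exact ((hcont t).sub (hcont 0)).add ((hw'.intervalIntegrable 0 1).const_mul _)
  have hdiff : ∫ x in (0 : ℝ)..1, Φ t x * deriv w x = (∫ x in (0 : ℝ)..1, Φ 0 x * deriv w x)
      + (∫ x in (0 : ℝ)..1, ∫ s in (0 : ℝ)..t, p (s + x) * deriv w x)
      - (∫ s in (0 : ℝ)..t, p s) * (w 1 - w 0) := by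
    rw [← hftc, ← intervalIntegral.integral_const_mul, ← intervalIntegral.integral_add (hcont 0) hmid,
      ← intervalIntegral.integral_sub ((hcont 0).add hmid)
        ((hw'.intervalIntegrable 0 1).const_mul _)]
    refine intervalIntegral.integral_congr fun x _ => ?_
    simp only [intervalIntegral.integral_mul_const, hΦsub x]
    ring
  rw [hparts t, hparts 0, hdiff, hfub, hΦsub 1]
  ring

theorem IsProfile.comp_sub_one (hp : IsProfile p) : IsProfile fun r => p (r - 1) := by
  refine ⟨hp.measurable.comp (by fun_prop), fun R => ?_⟩
  have := (memLp_indicator_iff_restrict measurableSet_Iio).2 (hp.memLp (R - 1))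
  have := this.comp_measurePreserving (measurePreserving_sub_right volume (1 : ℝ))
  rw [← memLp_indicator_iff_restrict measurableSet_Iio]
  refine this.ae_eq (ae_of_all _ fun x => ?_)
  simp [Set.indicator]

theorem integral_reflect (p : ℝ → ℝ) (s : ℝ) (f : ℝ → ℝ) :
    ∫ x in (0 : ℝ)..1, p (s + x - 1) * f (1 - x) = ∫ x in (0 : ℝ)..1, p (s - x) * f x := by
  have := intervalIntegral.integral_comp_sub_left (fun x => p (s - x) * f x) (1 : ℝ)
    (a := 0) (b := 1)
  simp only [sub_self, sub_zero] at this
  rw [← this]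
  refine intervalIntegral.integral_congr fun x _ => ?_
  simp only [show s + x - 1 = s - (1 - x) by ring]

/-- Reflection of the space variable in `IsProfile.green_add`. -/
theorem IsProfile.green_sub (hp : IsProfile p) {w : ℝ → ℝ} (hw : ContDiff ℝ ∞ w) (t : ℝ) :
    (∫ x in (0 : ℝ)..1, p (t - x) * w x) - (∫ x in (0 : ℝ)..1, p (0 - x) * w x) =
      w 0 * (∫ s in (0 : ℝ)..t, p s) - w 1 * (∫ s in (0 : ℝ)..t, p (s - 1))
        + ∫ s in (0 : ℝ)..t, ∫ x in (0 : ℝ)..1, p (s - x) * deriv w x := by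
  -- Under `x ↦ 1 - x` the term `p(s-x)` becomes `p(s+x-1)`, a wave of the previous kind with
  -- profile `p(· - 1)`.
  have hq := hp.comp_sub_one
  have hv : ContDiff ℝ ∞ fun x => w (1 - x) := hw.comp (by fun_prop)
  have h := hq.green_add hv t
  have e := integral_reflect p
  have hd : ∀ x, deriv (fun x => w (1 - x)) x = - deriv w (1 - x) := fun x =>
    deriv_comp_const_sub w 1 x
  simp only [hd, e, sub_self, sub_zero, add_sub_cancel_right, mul_neg,
    intervalIntegral.integral_neg] at h
  linarith

theorem IsProfile.intervalIntegrable_inner_add (hp : IsProfile p) {g : ℝ → ℝ} (hg : Continuous g) (t : ℝ) :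
    IntervalIntegrable (fun s => ∫ x in (0 : ℝ)..1, p (s + x) * g x) volume 0 t := by
  have h := hp.integrableOn_prod hg t
  rw [IntegrableOn, Measure.volume_eq_prod, ← Measure.prod_restrict] at h
  have := h.integral_prod_right
  rw [intervalIntegrable_iff]
  refine this.congr (ae_of_all _ fun s => ?_)
  simp only [Function.uncurry, intervalIntegral.integral_of_le zero_le_one, uIoc_of_le zero_le_one]

theorem IsProfile.intervalIntegrable_inner_sub (hp : IsProfile p) {g : ℝ → ℝ} (hg : Continuous g)
    (t : ℝ) :
    IntervalIntegrable (fun s => ∫ x in (0 : ℝ)..1, p (s - x) * g x) volume 0 t := by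
  have h := hp.comp_sub_one.intervalIntegrable_inner_add
    (show Continuous fun x : ℝ => g (1 - x) by fun_prop) t
  simpa only [integral_reflect] using h

/-- The difference of the two transport identities. Test functions with `w 0 = 0` read off the
control `p(s+1) + p(s-1)`, those with `w 1 = 0` the flux `2 p(s)`. -/
theorem wave_green (hp : IsProfile p) {w : ℝ → ℝ} (hw : ContDiff ℝ ∞ w) (t : ℝ) :
    (∫ x, waveVel p t x * w x ∂spaceMeasure) - (∫ x, waveVel p 0 x * w x ∂spaceMeasure) =
      w 1 * (∫ s in (0 : ℝ)..t, (p (s + 1) + p (s - 1))) - w 0 * (∫ s in (0 : ℝ)..t, 2 * p s)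
        - ∫ s in (0 : ℝ)..t, ∫ x, deriv (wavePos p s) x * deriv w x ∂spaceMeasure := by
  have hw' : Continuous (deriv w) := hw.continuous_deriv (by simp)
  have hvel (t : ℝ) : ∫ x, waveVel p t x * w x ∂spaceMeasure =
      (∫ x in (0 : ℝ)..1, p (t + x) * w x) - ∫ x in (0 : ℝ)..1, p (t - x) * w x := by
    rw [integral_spaceMeasure, ← intervalIntegral.integral_sub
      ((hp.intervalIntegrable_add t 0 1).mul_continuousOn hw.continuous.continuousOn)
      ((hp.intervalIntegrable_sub t 0 1).mul_continuousOn hw.continuous.continuousOn)]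
    simp only [waveVel, sub_mul]
  have hder (s : ℝ) : ∫ x, deriv (wavePos p s) x * deriv w x ∂spaceMeasure =
      (∫ x in (0 : ℝ)..1, p (s + x) * deriv w x) + ∫ x in (0 : ℝ)..1, p (s - x) * deriv w x := by
    rw [← intervalIntegral.integral_add
      ((hp.intervalIntegrable_add s 0 1).mul_continuousOn hw'.continuousOn)
      ((hp.intervalIntegrable_sub s 0 1).mul_continuousOn hw'.continuousOn),
      ← integral_spaceMeasure]
    refine integral_congr_ae ?_
    filter_upwards [deriv_wavePos hp s] with x hx
    rw [hx, add_mul]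
  have h1 := hp.green_add hw t
  have h2 := hp.green_sub hw t
  simp only [hvel, hder]
  have hadd : IntervalIntegrable (fun s => p (s + 1)) volume 0 t := by
    simpa only [add_comm] using hp.intervalIntegrable_add 1 0 t
  rw [intervalIntegral.integral_add hadd (hp.comp_sub_one.intervalIntegrable 0 t),
    intervalIntegral.integral_add (hp.intervalIntegrable_inner_add hw' t)
      (hp.intervalIntegrable_inner_sub hw' t), intervalIntegral.integral_const_mul]
  linarith

/-- D'Alembert's solution. -/
theorem wave_isSolution (hp : IsProfile p) {I : Set ℝ} (hI : ∀ t ∈ I, 0 ≤ t)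
    {y₀ y₁ u : ℝ → ℝ} (hy : IsInitialData y₀ y₁)
    (h₀ : ∀ᵐ x ∂spaceMeasure, p x + p (-x) = deriv y₀ x)
    (h₁ : ∀ᵐ x ∂spaceMeasure, p x - p (-x) = y₁ x)
    (hu : ∀ᵐ t, t ∈ I → 0 < t → u t = p (t + 1) + p (t - 1)) (hIc : I.OrdConnected)
    (hI0 : (0 : ℝ) ∈ I) :
    IsSolution I y₀ y₁ u (wavePos p) (waveVel p) where
  absCont t _ := wavePos_absolutelyContinuous hp t
  deriv_continuous := deriv_wavePos_continuousInL2 hp I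
  velocity_continuous := waveVel_continuousInL2 hp I
  hasDeriv := wavePos_hasDerivInL2 hp I
  dirichlet t _ := by simp [wavePos]
  init_position x hx := by
    have hac := hy.absCont.mono (c := 0) (d := x) (uIcc_subset_uIcc (by simp) (by simpa using hx))
    have := hac.integral_deriv_eq_sub
    rw [hy.zero_left, sub_zero] at this
    rw [← this]
    rw [ae_spaceMeasure_iff] at h₀
    refine intervalIntegral.integral_congr_ae ?_
    have h1 : ∀ᵐ x : ℝ, x ≠ 1 := by simp [ae_iff, measure_singleton]
    filter_upwards [h₀, h1] with r hr hr1 hrx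
    rw [uIoc_of_le hx.1] at hrx
    simpa using hr ⟨hrx.1, lt_of_le_of_ne (hrx.2.trans hx.2) hr1⟩
  init_velocity := by
    filter_upwards [h₁] with x hx
    simp [waveVel, hx]
  weak_form w hw hw0 t ht := by
    rw [wave_green hp hw t, hw0]
    have : ∫ s in (0 : ℝ)..t, u s = ∫ s in (0 : ℝ)..t, (p (s + 1) + p (s - 1)) := by
      refine intervalIntegral.integral_congr_ae ?_
      filter_upwards [hu] with s hs hst
      rw [uIoc_of_le (hI t ht)] at hst
      exact hs (hIc.out hI0 ht (Ioc_subset_Icc_self hst)) hst.1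
    rw [this]
    ring

theorem wave_isLeftFlux (hp : IsProfile p) (I : Set ℝ) :
    IsLeftFlux I (wavePos p) (waveVel p) (fun t => 2 * p t) where
  integrable t _ := (hp.intervalIntegrable 0 t).const_mul 2
  green w hw hw1 t _ := by
    rw [wave_green hp hw t, hw1]
    ring

end Green

/-! ### Uniqueness of finite energy solutions and of their flux -/

/-- The real Hilbert space `L²(0,1)`. -/
abbrev L2Space : Type := Lp ℝ 2 spaceMeasure

theorem inner_eq_integral {F G : L2Space} {f g : ℝ → ℝ} (hf : F =ᵐ[spaceMeasure] f)
    (hg : G =ᵐ[spaceMeasure] g) : inner ℝ F G = ∫ x, f x * g x ∂spaceMeasure := by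
  rw [L2.inner_def]
  refine integral_congr_ae ?_
  filter_upwards [hf, hg] with x hx hx'
  rw [hx, hx']
  simp [mul_comm]

theorem ContinuousInL2.exists_lp {I : Set ℝ} {f : ℝ → ℝ → ℝ} (hf : ContinuousInL2 I f) :
    ∃ F : ℝ → L2Space, ContinuousOn F I ∧ ∀ t ∈ I, F t =ᵐ[spaceMeasure] f t := by
  classical
  let F : ℝ → L2Space := fun t => if h : MemLp (f t) 2 spaceMeasure then h.toLp else 0
  have hF : ∀ t ∈ I, F t =ᵐ[spaceMeasure] f t := fun t ht => by
    simp only [F, dif_pos (hf t ht).1]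
    exact (hf t ht).1.coeFn_toLp
  refine ⟨F, fun t ht => ?_, hF⟩
  rw [ContinuousWithinAt, Lp.tendsto_Lp_iff_tendsto_eLpNorm']
  refine (hf t ht).2.congr' ?_
  filter_upwards [self_mem_nhdsWithin] with s hs
  refine eLpNorm_congr_ae ?_
  filter_upwards [hF s hs, hF t ht] with x h1 h2
  simp [h1, h2]

theorem AbsolutelyContinuousOnInterval.memLp_spaceMeasure {f : ℝ → ℝ}
    (hf : AbsolutelyContinuousOnInterval f 0 1) : MemLp f 2 spaceMeasure := by
  have hc : ContinuousOn f (Icc 0 1) := by simpa using hf.continuousOn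
  obtain ⟨C, hC⟩ := isCompact_Icc.exists_bound_of_continuousOn hc
  refine MemLp.of_bound ((hc.mono Ioo_subset_Icc_self).aestronglyMeasurable measurableSet_Ioo) C ?_
  rw [ae_spaceMeasure_iff]
  exact ae_of_all _ fun x hx => hC x (Ioo_subset_Icc_self hx)

/-- A solution seen as a curve in `L²(0,1)`. -/
theorem IsSolution.exists_lp {I : Set ℝ} {y₀ y₁ u : ℝ → ℝ} {y yt : ℝ → ℝ → ℝ}
    (h : IsSolution I y₀ y₁ u y yt) :
    ∃ Y X V : ℝ → L2Space, ContinuousOn X I ∧ (∀ t ∈ I, HasDerivWithinAt Y (V t) I t) ∧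
      (∀ t ∈ I, Y t =ᵐ[spaceMeasure] y t) ∧ (∀ t ∈ I, X t =ᵐ[spaceMeasure] deriv (y t)) ∧
      ∀ t ∈ I, V t =ᵐ[spaceMeasure] yt t := by
  classical
  obtain ⟨X, hXc, hX⟩ := h.deriv_continuous.exists_lp
  obtain ⟨V, -, hV⟩ := h.velocity_continuous.exists_lp
  let Y : ℝ → L2Space := fun t => if h : MemLp (y t) 2 spaceMeasure then h.toLp else 0
  have hY : ∀ t ∈ I, Y t =ᵐ[spaceMeasure] y t := fun t ht => by
    have hm := (h.absCont t ht).memLp_spaceMeasure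
    simp only [Y, dif_pos hm]
    exact hm.coeFn_toLp
  refine ⟨Y, X, V, hXc, fun t ht => ?_, hY, hX, hV⟩
  rw [hasDerivWithinAt_iff_tendsto_slope, Lp.tendsto_Lp_iff_tendsto_eLpNorm']
  refine (h.hasDeriv t ht).congr' ?_
  filter_upwards [self_mem_nhdsWithin] with s hs
  refine eLpNorm_congr_ae ?_
  rw [slope_def_module]
  filter_upwards [hY s hs.1, hY t ht, hV t ht, Lp.coeFn_smul (s - t)⁻¹ (Y s - Y t),
    Lp.coeFn_sub (Y s) (Y t)] with x h1 h2 h3 h4 h5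
  rw [Pi.sub_apply, h4, Pi.smul_apply, h5, Pi.sub_apply, h1, h2, h3, smul_eq_mul]

/-- Approximate `f'` by a smooth `g` and integrate from `0`. On the unit interval the uniform error
of the primitive is at most the `L²` error of the derivative. -/
theorem exists_smooth_primitive_approx {f : ℝ → ℝ} (hf : AbsolutelyContinuousOnInterval f 0 1)
    (hf0 : f 0 = 0) (hf' : MemLp (deriv f) 2 spaceMeasure) {ε : ℝ} (hε : 0 < ε) :
    ∃ w : ℝ → ℝ, ContDiff ℝ ∞ w ∧ w 0 = 0 ∧ eLpNorm (f - w) 2 spaceMeasure ≤ ENNReal.ofReal ε ∧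
      eLpNorm (deriv f - deriv w) 2 spaceMeasure ≤ ENNReal.ofReal ε := by
  obtain ⟨g, -, hg, hgε⟩ := hf'.exist_eLpNorm_sub_le (by norm_num) (by norm_num) hε
  let w : ℝ → ℝ := fun x => ∫ r in (0 : ℝ)..x, g r
  have hd : ∀ x, HasDerivAt w (g x) x := fun x =>
    (hg.continuous.integral_hasStrictDerivAt 0 x).hasDerivAt
  have hdw : deriv w = g := funext fun x => (hd x).deriv
  refine ⟨w, ?_, by simp [w], ?_, by rwa [hdw]⟩
  · rw [contDiff_infty_iff_deriv, hdw]
    exact ⟨fun x => (hd x).differentiableAt, hg⟩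
  have hint : IntervalIntegrable (fun r => deriv f r - g r) volume 0 1 :=
    hf.intervalIntegrable_deriv.sub (hg.continuous.intervalIntegrable 0 1)
  have hmeas : AEStronglyMeasurable (deriv f - g) spaceMeasure :=
    hf'.aestronglyMeasurable.sub hg.continuous.aestronglyMeasurable
  have hb : ∀ᵐ x ∂spaceMeasure, ‖(f - w) x‖ ≤ ε := by
    rw [ae_spaceMeasure_iff]
    refine ae_of_all _ fun x hx => ?_
    have h1 := (hf.mono (c := 0) (d := x)
      (uIcc_subset_uIcc (by simp) (by simpa using Ioo_subset_Icc_self hx))).integral_deriv_eq_sub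
    have hint' : IntervalIntegrable (deriv f) volume 0 x := hf.intervalIntegrable_deriv.mono_set
      (uIcc_subset_uIcc (by simp) (by simpa using Ioo_subset_Icc_self hx))
    have h2 : (f - w) x = ∫ r in (0 : ℝ)..x, (deriv f r - g r) := by
      rw [intervalIntegral.integral_sub hint' (hg.continuous.intervalIntegrable 0 x), h1, hf0]
      simp [w]
    rw [h2, ← ENNReal.ofReal_le_ofReal_iff hε.le, ofReal_norm]
    refine le_trans ?_ hgε
    refine le_trans ?_ (eLpNorm_le_eLpNorm_of_exponent_le (p := 1) (by norm_num) hmeas)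
    rw [eLpNorm_one_eq_lintegral_enorm, intervalIntegral.integral_of_le hx.1.le,
      integral_Ioc_eq_integral_Ioo]
    refine (enorm_integral_le_lintegral_enorm _).trans ?_
    exact lintegral_mono_set (Ioo_subset_Ioo_right hx.2.le)
  have := eLpNorm_le_of_ae_bound (p := 2) hb
  simpa using this

/-- Duality relations with smooth test functions extend to `H¹` test functions. -/
theorem inner_eq_neg_inner_of_smooth {V W F F' : L2Space} {f : ℝ → ℝ}
    (hf : AbsolutelyContinuousOnInterval f 0 1) (hf0 : f 0 = 0) (hF : F =ᵐ[spaceMeasure] f)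
    (hF' : F' =ᵐ[spaceMeasure] deriv f)
    (h : ∀ w : ℝ → ℝ, ContDiff ℝ ∞ w → w 0 = 0 → ∀ G G' : L2Space, G =ᵐ[spaceMeasure] w →
      G' =ᵐ[spaceMeasure] deriv w → inner ℝ V G = - inner ℝ W G') :
    inner ℝ V F = - inner ℝ W F' := by
  have hm : MemLp (deriv f) 2 spaceMeasure := (Lp.memLp F').ae_eq hF'
  rw [← add_eq_zero_iff_eq_neg, ← abs_nonpos_iff]
  refine le_of_forall_pos_le_add fun δ hδ => ?_
  -- Chosen so that the total error `(‖V‖ + ‖W‖) ε` stays below `δ`; the `1` keeps the denominator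
  -- positive.
  let ε := δ / (‖V‖ + ‖W‖ + 1)
  have hε : 0 < ε := by positivity
  obtain ⟨w, hw, hw0, h1, h2⟩ := exists_smooth_primitive_approx hf hf0 hm hε
  have hmw : MemLp w 2 spaceMeasure := AbsolutelyContinuousOnInterval.memLp_spaceMeasure
    (hw.of_le (by simp)).contDiffOn.absolutelyContinuousOnInterval
  have hcw : ContDiff ℝ 1 (deriv w) := ((contDiff_infty_iff_deriv.1 hw).2).of_le (by simp)
  have hmw' : MemLp (deriv w) 2 spaceMeasure := AbsolutelyContinuousOnInterval.memLp_spaceMeasure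
    hcw.contDiffOn.absolutelyContinuousOnInterval
  have hn (A : L2Space) (a b : ℝ → ℝ) (hb : MemLp b 2 spaceMeasure) (hA : A =ᵐ[spaceMeasure] a)
      (hab : eLpNorm (a - b) 2 spaceMeasure ≤ ENNReal.ofReal ε) : ‖A - hb.toLp‖ ≤ ε := by
    rw [Lp.norm_def]
    refine ENNReal.toReal_le_of_le_ofReal hε.le (le_trans (le_of_eq (eLpNorm_congr_ae ?_)) hab)
    filter_upwards [Lp.coeFn_sub A hb.toLp, hA, hb.coeFn_toLp] with x e1 e2 e3
    rw [e1, Pi.sub_apply, e2, e3, Pi.sub_apply]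
  have k1 := hn F f w hmw hF h1
  have k2 := hn F' (deriv f) (deriv w) hmw' hF' h2
  have key := h w hw hw0 hmw.toLp hmw'.toLp hmw.coeFn_toLp hmw'.coeFn_toLp
  have : inner ℝ V F + inner ℝ W F' =
      inner ℝ V (F - hmw.toLp) + inner ℝ W (F' - hmw'.toLp) := by
    rw [inner_sub_right, inner_sub_right, key]
    ring
  rw [this]
  calc |inner ℝ V (F - hmw.toLp) + inner ℝ W (F' - hmw'.toLp)|
      ≤ ‖V‖ * ‖F - hmw.toLp‖ + ‖W‖ * ‖F' - hmw'.toLp‖ :=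
        (abs_add_le _ _).trans (add_le_add (abs_real_inner_le_norm _ _)
          (abs_real_inner_le_norm _ _))
    _ ≤ ‖V‖ * ε + ‖W‖ * ε := by gcongr
    _ ≤ (‖V‖ + ‖W‖ + 1) * ε := by nlinarith
    _ = 0 + δ := by
        simp only [ε]
        field_simp
        ring

/-- Energy argument: `|D|² + |∫₀ᵗ X|²` is conserved. -/
theorem eq_zero_of_inner_eq_neg_inner_integral {H : Type*} [NormedAddCommGroup H]
    [InnerProductSpace ℝ H] [CompleteSpace H] {T : ℝ} (hT : 0 < T) {D V X : ℝ → H}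
    (hX : ContinuousOn X (Icc 0 T)) (hD : ∀ t ∈ Icc 0 T, HasDerivWithinAt D (V t) (Icc 0 T) t)
    (hD0 : D 0 = 0)
    (h : ∀ t ∈ Icc 0 T, inner ℝ (V t) (D t) = - inner ℝ (∫ s in (0 : ℝ)..t, X s) (X t)) :
    ∀ t ∈ Icc 0 T, D t = 0 := by
  -- The constant extension is continuous on the line, so its primitive is differentiable at the end
  -- points too.
  let X' : ℝ → H := IccExtend hT.le ((Icc 0 T).domRestrict X)
  have hX'c : Continuous X' := (continuousOn_iff_continuous_domRestrict.1 hX).Icc_extend'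
  have hXX' : ∀ t ∈ Icc 0 T, X' t = X t := fun t ht => by simp [X', IccExtend_of_mem _ _ ht, Set.domRestrict]
  let W : ℝ → H := fun t => ∫ s in (0 : ℝ)..t, X' s
  have hW : ∀ t ∈ Icc 0 T, W t = ∫ s in (0 : ℝ)..t, X s := fun t ht => by
    refine intervalIntegral.integral_congr fun s hs => hXX' s ?_
    rw [uIcc_of_le ht.1] at hs
    exact ⟨hs.1, hs.2.trans ht.2⟩
  let E : ℝ → ℝ := fun t => inner ℝ (D t) (D t) + inner ℝ (W t) (W t)
  have hE : ∀ t ∈ Icc 0 T, HasDerivWithinAt E 0 (Icc 0 T) t := fun t ht => by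
    have h1 := (hD t ht).inner ℝ (hD t ht)
    have hWd : HasDerivWithinAt W (X t) (Icc 0 T) t := by
      rw [← hXX' t ht]
      exact (hX'c.integral_hasStrictDerivAt 0 t).hasDerivAt.hasDerivWithinAt
    refine (h1.add (hWd.inner ℝ hWd)).congr_deriv ?_
    have hh := h t ht
    rw [← hW t ht] at hh
    rw [real_inner_comm (V t) (D t), hh, real_inner_comm (W t) (X t)]
    ring
  have hconst := constant_of_derivWithin_zero (f := E)
    (fun t ht => (hE t ht).differentiableWithinAt)
    (fun t ht => (hE t (Ico_subset_Icc_self ht)).derivWithin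
      (uniqueDiffOn_Icc hT t (Ico_subset_Icc_self ht)))
  intro t ht
  have h0 := hconst t ht
  simp only [E, hD0, W, intervalIntegral.integral_same, inner_zero_right, add_zero] at h0
  have h1 := real_inner_self_nonneg (x := D t)
  have h2 := real_inner_self_nonneg (x := ∫ s in (0 : ℝ)..t, X' s)
  exact inner_self_eq_zero.1 (le_antisymm (by linarith) h1)

theorem eqOn_of_ae_eq_spaceMeasure {f g : ℝ → ℝ} (hf : AbsolutelyContinuousOnInterval f 0 1)
    (hg : AbsolutelyContinuousOnInterval g 0 1) (h : f =ᵐ[spaceMeasure] g) :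
    ∀ x ∈ Icc (0 : ℝ) 1, f x = g x := by
  have h' : f =ᵐ[volume.restrict (Icc (0 : ℝ) 1)] g := by
    rwa [spaceMeasure, restrict_Ioo_eq_restrict_Icc] at h
  exact Measure.eqOn_Icc_of_ae_eq volume zero_ne_one h' (by simpa using hf.continuousOn)
    (by simpa using hg.continuousOn)

theorem deriv_ae_eq_spaceMeasure {f g : ℝ → ℝ} (h : ∀ x ∈ Icc (0 : ℝ) 1, f x = g x) :
    deriv f =ᵐ[spaceMeasure] deriv g := by
  rw [EventuallyEq, ae_spaceMeasure_iff]
  refine ae_of_all _ fun x hx => Filter.EventuallyEq.deriv_eq ?_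
  filter_upwards [Icc_mem_nhds hx.1 hx.2] with z hz using h z hz

/-- Uniqueness of the finite energy solution. -/
theorem IsSolution.unique {T : ℝ} (hT : 0 < T) {y₀ y₁ u : ℝ → ℝ} {y yt z zt : ℝ → ℝ → ℝ}
    (hy : IsSolution (Icc 0 T) y₀ y₁ u y yt) (hz : IsSolution (Icc 0 T) y₀ y₁ u z zt) :
    ∀ t ∈ Icc 0 T, (∀ x ∈ Icc (0 : ℝ) 1, y t x = z t x) ∧ yt t =ᵐ[spaceMeasure] zt t := by
  obtain ⟨Y, X, V, hXc, hYd, hY, hX, hV⟩ := hy.exists_lp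
  obtain ⟨Y', X', V', hXc', hYd', hY', hX', hV'⟩ := hz.exists_lp
  have h0 : (0 : ℝ) ∈ Icc 0 T := ⟨le_rfl, hT.le⟩
  have hac : ∀ t ∈ Icc 0 T, AbsolutelyContinuousOnInterval (y t - z t) 0 1 := fun t ht =>
    (hy.absCont t ht).sub (hz.absCont t ht)
  have hDd : ∀ t ∈ Icc 0 T, HasDerivWithinAt (fun t => Y t - Y' t) (V t - V' t) (Icc 0 T) t :=
    fun t ht => (hYd t ht).sub (hYd' t ht)
  have hV0 : V 0 = V' 0 := by
    refine Lp.ext ?_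
    exact (hV 0 h0).trans (hy.init_velocity.trans (hz.init_velocity.symm.trans (hV' 0 h0).symm))
  have hY0 : Y 0 - Y' 0 = 0 := by
    rw [sub_eq_zero]
    refine Lp.ext ((hY 0 h0).trans (EventuallyEq.trans ?_ (hY' 0 h0).symm))
    rw [EventuallyEq, ae_spaceMeasure_iff]
    refine ae_of_all _ fun x hx => ?_
    rw [hy.init_position x (Ioo_subset_Icc_self hx), hz.init_position x (Ioo_subset_Icc_self hx)]
  have hDX : ∀ t ∈ Icc 0 T, X t - X' t =ᵐ[spaceMeasure] deriv (y t - z t) := fun t ht => by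
    have e1 := (hy.absCont t ht).ae_differentiableAt
    have e2 := (hz.absCont t ht).ae_differentiableAt
    have e3 : ∀ᵐ x ∂spaceMeasure, DifferentiableAt ℝ (y t) x ∧ DifferentiableAt ℝ (z t) x := by
      rw [ae_spaceMeasure_iff]
      filter_upwards [e1, e2] with x e1 e2 hx
      have : x ∈ uIcc (0 : ℝ) 1 := by simpa using Ioo_subset_Icc_self hx
      exact ⟨e1 this, e2 this⟩
    filter_upwards [Lp.coeFn_sub (X t) (X' t), hX t ht, hX' t ht, e3] with x a1 a2 a3 a4
    rw [a1, Pi.sub_apply, a2, a3, deriv_sub a4.1 a4.2]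
  have hsub {t : ℝ} (ht : t ∈ Icc 0 T) : uIcc 0 t ⊆ Icc 0 T := by
    rw [uIcc_of_le ht.1]
    exact Icc_subset_Icc_right ht.2
  have hXi : ∀ t ∈ Icc 0 T, IntervalIntegrable X volume 0 t := fun t ht =>
    (hXc.mono (hsub ht)).intervalIntegrable
  have hXi' : ∀ t ∈ Icc 0 T, IntervalIntegrable X' volume 0 t := fun t ht =>
    (hXc'.mono (hsub ht)).intervalIntegrable
  have inner_int : ∀ (F : ℝ → L2Space) (t : ℝ), IntervalIntegrable F volume 0 t → ∀ G : L2Space,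
      inner ℝ (∫ s in (0 : ℝ)..t, F s) G = ∫ s in (0 : ℝ)..t, inner ℝ (F s) G := by
    intro F t hF G
    have := (innerSL ℝ G).intervalIntegral_comp_comm hF
    simp only [innerSL_apply_apply] at this
    rw [real_inner_comm, ← this]
    refine intervalIntegral.integral_congr fun s _ => real_inner_comm _ _
  -- The control and the initial velocity cancel in the difference of the weak forms.
  have hweak : ∀ t ∈ Icc 0 T, ∀ w : ℝ → ℝ, ContDiff ℝ ∞ w → w 0 = 0 → ∀ G G' : L2Space,
      G =ᵐ[spaceMeasure] w → G' =ᵐ[spaceMeasure] deriv w →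
      inner ℝ (V t - V' t) G = - inner ℝ (∫ s in (0 : ℝ)..t, (X s - X' s)) G' := by
    intro t ht w hw hw0 G G' hG hG'
    have e1 := hy.weak_form w hw hw0 t ht
    have e2 := hz.weak_form w hw hw0 t ht
    rw [← inner_eq_integral (hV t ht) hG, ← inner_eq_integral (hV 0 h0) hG] at e1
    rw [← inner_eq_integral (hV' t ht) hG, ← inner_eq_integral (hV' 0 h0) hG] at e2
    have i1 : ∫ s in (0 : ℝ)..t, ∫ x, deriv (y s) x * deriv w x ∂spaceMeasure =
        inner ℝ (∫ s in (0 : ℝ)..t, X s) G' := by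
      rw [inner_int X t (hXi t ht)]
      exact intervalIntegral.integral_congr fun s hs =>
        (inner_eq_integral (hX s (hsub ht hs)) hG').symm
    have i2 : ∫ s in (0 : ℝ)..t, ∫ x, deriv (z s) x * deriv w x ∂spaceMeasure =
        inner ℝ (∫ s in (0 : ℝ)..t, X' s) G' := by
      rw [inner_int X' t (hXi' t ht)]
      exact intervalIntegral.integral_congr fun s hs =>
        (inner_eq_integral (hX' s (hsub ht hs)) hG').symm
    rw [i1] at e1
    rw [i2] at e2
    rw [intervalIntegral.integral_sub (hXi t ht) (hXi' t ht), inner_sub_left, inner_sub_left]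
    rw [hV0] at e1
    linarith
  -- The difference of the two states at time `t` is itself the test function; it is admissible
  -- since it vanishes at `0` and lies in `H¹`.
  have hD := eq_zero_of_inner_eq_neg_inner_integral hT (hXc.sub hXc') hDd hY0 fun t ht => by
    refine inner_eq_neg_inner_of_smooth (hac t ht) ?_ ?_ (hDX t ht) (hweak t ht)
    · simp [hy.dirichlet t ht, hz.dirichlet t ht]
    · filter_upwards [Lp.coeFn_sub (Y t) (Y' t), hY t ht, hY' t ht] with x a1 a2 a3
      rw [a1, Pi.sub_apply, a2, a3, Pi.sub_apply]
  intro t ht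
  have hYY : Y t = Y' t := sub_eq_zero.1 (hD t ht)
  refine ⟨eqOn_of_ae_eq_spaceMeasure (hy.absCont t ht) (hz.absCont t ht) ?_, ?_⟩
  · exact (hY t ht).symm.trans (hYY ▸ hY' t ht)
  · have h1 : HasDerivWithinAt (fun t => Y t - Y' t) 0 (Icc 0 T) t :=
      (hasDerivWithinAt_const t _ (0 : L2Space)).congr hD (hD t ht)
    have h2 := (uniqueDiffOn_Icc hT t ht).eq_deriv _ (hDd t ht) h1
    rw [sub_eq_zero] at h2
    exact (hV t ht).symm.trans (h2 ▸ hV' t ht)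

theorem ae_eq_of_intervalIntegral_eq {T : ℝ} {v v' : ℝ → ℝ} (hv : IntervalIntegrable v volume 0 T)
    (hv' : IntervalIntegrable v' volume 0 T)
    (h : ∀ t ∈ Icc 0 T, ∫ s in (0 : ℝ)..t, v s = ∫ s in (0 : ℝ)..t, v' s) :
    ∀ᵐ t, t ∈ Ioo 0 T → v t = v' t := by
  filter_upwards [(hv.sub hv').ae_hasDerivAt_integral] with t ht htT
  have htI := Ioo_subset_Icc_self htT
  have hT : 0 ≤ T := htI.1.trans htI.2
  have h1 := ht (by rwa [uIcc_of_le hT]) 0 (by simp)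
  have h2 : HasDerivAt (fun x => ∫ s in (0 : ℝ)..x, (v s - v' s)) 0 t := by
    refine (hasDerivAt_const t (0 : ℝ)).congr_of_eventuallyEq ?_
    filter_upwards [Icc_mem_nhds htT.1 htT.2] with s hs
    have hsub : uIcc 0 s ⊆ uIcc 0 T := by
      rw [uIcc_of_le hs.1, uIcc_of_le hT]
      exact Icc_subset_Icc_right hs.2
    rw [intervalIntegral.integral_sub (hv.mono_set hsub) (hv'.mono_set hsub), h s hs, sub_self]
  exact sub_eq_zero.1 (h1.unique h2)

/-- A single test function with `w 0 = 1` and `w 1 = 0` recovers the running integral of the flux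
from the state, which is unique. -/
theorem IsLeftFlux.unique {T : ℝ} (hT : 0 < T) {y₀ y₁ u v v' : ℝ → ℝ} {y yt z zt : ℝ → ℝ → ℝ}
    (hy : IsSolution (Icc 0 T) y₀ y₁ u y yt) (hz : IsSolution (Icc 0 T) y₀ y₁ u z zt)
    (hv : IsLeftFlux (Icc 0 T) y yt v) (hv' : IsLeftFlux (Icc 0 T) z zt v') :
    ∀ᵐ t, t ∈ Ioo 0 T → v t = v' t := by
  have huniq := hy.unique hT hz
  have hTT : T ∈ Icc 0 T := ⟨hT.le, le_rfl⟩
  have h0 : (0 : ℝ) ∈ Icc 0 T := ⟨le_rfl, hT.le⟩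
  refine ae_eq_of_intervalIntegral_eq (hv.integrable T hTT) (hv'.integrable T hTT) fun t ht => ?_
  have hw : ContDiff ℝ ∞ fun x : ℝ => 1 - x := by fun_prop
  have e1 := hv.green _ hw (by simp) t ht
  have e2 := hv'.green _ hw (by simp) t ht
  have i (s : ℝ) (hs : s ∈ Icc 0 T) : ∫ x, yt s x * (1 - x) ∂spaceMeasure =
      ∫ x, zt s x * (1 - x) ∂spaceMeasure := by
    refine integral_congr_ae ?_
    filter_upwards [(huniq s hs).2] with x hx
    rw [hx]
  have j : ∫ s in (0 : ℝ)..t, ∫ x, deriv (y s) x * deriv (fun x => 1 - x) x ∂spaceMeasure =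
      ∫ s in (0 : ℝ)..t, ∫ x, deriv (z s) x * deriv (fun x => 1 - x) x ∂spaceMeasure := by
    refine intervalIntegral.integral_congr fun s hs => integral_congr_ae ?_
    rw [uIcc_of_le ht.1] at hs
    filter_upwards [deriv_ae_eq_spaceMeasure (huniq s ⟨hs.1, hs.2.trans ht.2⟩).1] with x hx
    rw [hx]
  rw [i t ht, i 0 h0, j] at e1
  simp only [sub_zero] at e1 e2
  linarith

/-! ### Profiles built from blocks of length 2 -/

section Glue

/-- The function on `[-1,∞)` whose translate on `[2k-1,2k+1)` is `P k`. -/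
noncomputable def glue (P : ℕ → ℝ → ℝ) (τ : ℝ) : ℝ :=
  if τ < -1 then 0 else P ⌊(τ + 1) / 2⌋₊ (τ - 2 * (⌊(τ + 1) / 2⌋₊ : ℝ))

theorem glue_apply (P : ℕ → ℝ → ℝ) {k : ℕ} {τ : ℝ} (h : τ ∈ Ico (2 * (k : ℝ) - 1) (2 * k + 1)) :
    glue P τ = P k (τ - 2 * k) := by
  obtain ⟨h1, h2⟩ := h
  have hk : (0 : ℝ) ≤ k := k.cast_nonneg
  have : ⌊(τ + 1) / 2⌋₊ = k := by
    rw [Nat.floor_eq_iff (by linarith)]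
    constructor <;> linarith
  rw [glue, if_neg (by linarith), this]

theorem exists_mem_block {τ : ℝ} (h : -1 ≤ τ) :
    ∃ k : ℕ, τ ∈ Ico (2 * (k : ℝ) - 1) (2 * k + 1) := by
  refine ⟨⌊(τ + 1) / 2⌋₊, ?_⟩
  have h1 := Nat.floor_le (show 0 ≤ (τ + 1) / 2 by linarith)
  have h2 := Nat.lt_floor_add_one ((τ + 1) / 2)
  constructor <;> linarith

theorem memLp_comp_sub_right {f : ℝ → ℝ} (hf : MemLp f 2 volume) (c : ℝ) :
    MemLp (fun x => f (x - c)) 2 volume :=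
  hf.comp_measurePreserving (measurePreserving_sub_right volume c)

theorem memLp_comp_add_right {f : ℝ → ℝ} (hf : MemLp f 2 volume) (c : ℝ) :
    MemLp (fun x => f (x + c)) 2 volume :=
  hf.comp_measurePreserving (measurePreserving_add_right volume c)

/-- Only finitely many blocks meet a left half-line, so the glued function is there a finite sum of
translated square integrable pieces. -/
theorem glue_isProfile {P : ℕ → ℝ → ℝ} (hP : ∀ k, Measurable (P k))
    (hP2 : ∀ k, MemLp (P k) 2 volume) : IsProfile (glue P) := by
  constructor
  · have hm : Measurable fun q : ℕ × ℝ => P q.1 q.2 := measurable_from_prod_countable_right hP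
    have hfl : Measurable fun τ : ℝ => ⌊(τ + 1) / 2⌋₊ := Nat.measurable_floor.comp (by fun_prop)
    refine Measurable.ite measurableSet_Iio measurable_const
      (hm.comp (g := fun q : ℕ × ℝ => P q.1 q.2)
        (f := fun τ : ℝ => (⌊(τ + 1) / 2⌋₊, τ - 2 * (⌊(τ + 1) / 2⌋₊ : ℝ))) ?_)
    refine hfl.prodMk (measurable_id.sub (measurable_const.mul ?_))
    exact (measurable_from_nat (f := fun k : ℕ => (k : ℝ))).comp hfl
  · intro R
    obtain ⟨N, hN⟩ := exists_nat_ge R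
    let B : ℕ → Set ℝ := fun k => Ico (2 * (k : ℝ) - 1) (2 * k + 1)
    have hsum : MemLp (fun τ => ∑ k ∈ Finset.range (N + 1),
        (B k).indicator (fun τ => P k (τ - 2 * k)) τ) 2 volume :=
      memLp_finsetSum _ fun k _ => (memLp_comp_sub_right (hP2 k) _).indicator measurableSet_Ico
    refine (hsum.mono_measure Measure.restrict_le_self).ae_eq ?_
    rw [EventuallyEq, ae_restrict_iff' measurableSet_Iio]
    refine ae_of_all _ fun τ hτ => ?_
    have hτR : τ < N := lt_of_lt_of_le hτ hN
    rcases lt_or_ge τ (-1) with h | h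
    · rw [glue, if_pos h]
      refine Finset.sum_eq_zero fun k _ => indicator_of_notMem (fun hk => ?_) _
      have := hk.1
      have : (0 : ℝ) ≤ k := k.cast_nonneg
      linarith
    · obtain ⟨k, hk⟩ := exists_mem_block h
      rw [glue_apply P hk, Finset.sum_eq_single k]
      · exact indicator_of_mem hk _
      · intro j _ hjk
        refine indicator_of_notMem (fun hj => hjk ?_) _
        have h1 : (j : ℝ) < k + 1 := by linarith [hj.1, hk.2]
        have h2 : (k : ℝ) < j + 1 := by linarith [hj.2, hk.1]
        have h1' : j < k + 1 := by exact_mod_cast h1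
        have h2' : k < j + 1 := by exact_mod_cast h2
        omega
      · intro hk'
        exfalso
        simp only [Finset.mem_range, not_lt] at hk'
        have : ((N : ℝ) + 1) ≤ k := by exact_mod_cast hk'
        have : (0 : ℝ) ≤ k := k.cast_nonneg
        linarith [hk.1]

/-- The blocks of the profile generated by the initial profile `p₀` and the control `U`. -/
def controlBlock (p₀ U : ℝ → ℝ) : ℕ → ℝ → ℝ
  | 0 => p₀
  | k + 1 => fun s => U (s + (2 * k + 1)) - controlBlock p₀ U k s

/-- Read as `p(t+1) = U(t) - p(t-1)`, the Neumann condition determines each block from the preceding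
one, so every square integrable control comes from a profile. -/
theorem exists_profile {p₀ U : ℝ → ℝ} (h₀ : Measurable p₀) (h₀2 : MemLp p₀ 2 volume)
    (hU : Measurable U) (hU2 : MemLp U 2 volume) :
    ∃ p, IsProfile p ∧ (∀ τ ∈ Ico (-1 : ℝ) 1, p τ = p₀ τ) ∧
      ∀ t, 0 ≤ t → p (t + 1) + p (t - 1) = U t := by
  refine ⟨glue (controlBlock p₀ U), glue_isProfile (fun k => ?_) (fun k => ?_), fun τ hτ => ?_,
    fun t ht => ?_⟩
  · induction k with
    | zero => exact h₀
    | succ k ih => exact (hU.comp (by fun_prop)).sub ih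
  · induction k with
    | zero => exact h₀2
    | succ k ih => exact (memLp_comp_add_right hU2 _).sub ih
  · rw [glue_apply _ (k := 0) (by simpa using hτ)]
    simp [controlBlock]
  · obtain ⟨k, hk1, hk2⟩ := exists_mem_block (show -1 ≤ t - 1 by linarith)
    rw [glue_apply _ (k := k) ⟨hk1, hk2⟩, glue_apply _ (k := k + 1)
      ⟨by push_cast; linarith, by push_cast; linarith⟩]
    simp only [controlBlock]
    push_cast
    rw [show t + 1 - 2 * ((k : ℝ) + 1) = t - 1 - 2 * k by ring,
      show t - 1 - 2 * (k : ℝ) + (2 * k + 1) = t by ring]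
    ring

/-- The profile that equals `c k * p₀` on the `k`-th block. -/
noncomputable def blockProfile (c : ℕ → ℝ) (p₀ : ℝ → ℝ) : ℝ → ℝ := glue fun k s => c k * p₀ s

theorem blockProfile_isProfile (c : ℕ → ℝ) {p₀ : ℝ → ℝ} (h₀ : Measurable p₀)
    (h₀2 : MemLp p₀ 2 volume) : IsProfile (blockProfile c p₀) :=
  glue_isProfile (fun _ => h₀.const_mul _) fun _ => h₀2.const_mul _

end Glue

/-! ### From data and feasible controls to profiles -/

/-- `p₀` is the profile on `(-1,1)` of the initial data `y₀, y₁`. -/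
structure IsDataProfile (y₀ y₁ p₀ : ℝ → ℝ) : Prop where
  measurable : Measurable p₀
  memLp : MemLp p₀ 2 volume
  add_reflect : ∀ᵐ x ∂spaceMeasure, p₀ x + p₀ (-x) = deriv y₀ x
  sub_reflect : ∀ᵐ x ∂spaceMeasure, p₀ x - p₀ (-x) = y₁ x

/-- Solving the two reflection equations gives `(y₀' + y₁)/2` on `(0,1)` and the reflection of `(y₀'
- y₁)/2` on `(-1,0)`. Each half costs half the sum of the norms. -/
theorem IsInitialData.exists_dataProfile {y₀ y₁ : ℝ → ℝ} (hy : IsInitialData y₀ y₁) :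
    ∃ p₀, IsDataProfile y₀ y₁ p₀ ∧
      eLpNorm p₀ 2 volume ≤ L2norm 0 1 (deriv y₀) + L2norm 0 1 y₁ := by
  obtain ⟨z, hz, hzy⟩ := hy.velocity_memLp.aestronglyMeasurable
  have hzm := hz.measurable
  have hd := measurable_deriv y₀
  have hz2 : MemLp z 2 spaceMeasure := hy.velocity_memLp.ae_eq hzy
  let f : ℝ → ℝ := (Ioo 0 1).indicator ((1 / 2 : ℝ) • (deriv y₀ + z))
  let g : ℝ → ℝ := (Ioo 0 1).indicator ((1 / 2 : ℝ) • (deriv y₀ - z))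
  have hf : Measurable f := ((hd.add hzm).const_smul _).indicator measurableSet_Ioo
  have hg : Measurable g := ((hd.sub hzm).const_smul _).indicator measurableSet_Ioo
  have hf2 : MemLp f 2 volume := (memLp_indicator_iff_restrict measurableSet_Ioo).2
    ((hy.deriv_memLp.add hz2).const_smul _)
  have hg2 : MemLp g 2 volume := (memLp_indicator_iff_restrict measurableSet_Ioo).2
    ((hy.deriv_memLp.sub hz2).const_smul _)
  have hneg : MeasurePreserving (fun x : ℝ => -x) volume volume := Measure.measurePreserving_neg _
  have half : ‖(1 / 2 : ℝ)‖ₑ = 2⁻¹ := by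
    rw [Real.enorm_eq_ofReal (by norm_num), one_div, ENNReal.ofReal_inv_of_pos (by norm_num)]
    simp
  have hzn : eLpNorm z 2 spaceMeasure = L2norm 0 1 y₁ := (eLpNorm_congr_ae hzy).symm
  have hfn : eLpNorm f 2 volume ≤ 2⁻¹ * (L2norm 0 1 (deriv y₀) + L2norm 0 1 y₁) := by
    rw [eLpNorm_indicator_eq_eLpNorm_restrict measurableSet_Ioo, eLpNorm_const_smul, half, ← hzn]
    gcongr
    exact eLpNorm_add_le hd.aestronglyMeasurable hzm.aestronglyMeasurable (by norm_num)
  have hgn : eLpNorm g 2 volume ≤ 2⁻¹ * (L2norm 0 1 (deriv y₀) + L2norm 0 1 y₁) := by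
    rw [eLpNorm_indicator_eq_eLpNorm_restrict measurableSet_Ioo, eLpNorm_const_smul, half, ← hzn]
    gcongr
    exact eLpNorm_sub_le hd.aestronglyMeasurable hzm.aestronglyMeasurable (by norm_num)
  have hpos (x : ℝ) (hx : x ∈ Ioo (0 : ℝ) 1) : f x = (deriv y₀ x + z x) / 2 := by
    simp only [f, indicator_of_mem hx, Pi.smul_apply, Pi.add_apply, smul_eq_mul]
    ring
  have hpos' (x : ℝ) (hx : x ∈ Ioo (0 : ℝ) 1) : g x = (deriv y₀ x - z x) / 2 := by
    simp only [g, indicator_of_mem hx, Pi.smul_apply, Pi.sub_apply, smul_eq_mul]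
    ring
  have hzero (x : ℝ) (hx : x ∈ Ioo (0 : ℝ) 1) : f (-x) = 0 ∧ g (-x) = 0 := by
    have : -x ∉ Ioo (0 : ℝ) 1 := fun h => by linarith [hx.1, h.1]
    exact ⟨indicator_of_notMem this _, indicator_of_notMem this _⟩
  refine ⟨fun x => f x + g (-x), ⟨?_, ?_, ?_, ?_⟩, ?_⟩
  · exact hf.add (hg.comp measurable_neg)
  · exact hf2.add (hg2.comp_measurePreserving hneg)
  · rw [ae_spaceMeasure_iff]
    refine ae_of_all _ fun x hx => ?_
    rw [neg_neg, hpos x hx, hpos' x hx, (hzero x hx).1, (hzero x hx).2]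
    ring
  · have h2 := hzy
    rw [EventuallyEq, ae_spaceMeasure_iff] at h2
    rw [ae_spaceMeasure_iff]
    filter_upwards [h2] with x h2 hx
    rw [neg_neg, hpos x hx, hpos' x hx, (hzero x hx).1, (hzero x hx).2, h2 hx]
    ring
  · have hgneg : eLpNorm (g ∘ fun x => -x) 2 volume = eLpNorm g 2 volume :=
      eLpNorm_comp_measurePreserving hg.aestronglyMeasurable hneg
    have hadd : eLpNorm (f + g ∘ fun x => -x) 2 volume ≤
        eLpNorm f 2 volume + eLpNorm (g ∘ fun x => -x) 2 volume :=
      eLpNorm_add_le hf.aestronglyMeasurable (hg.comp measurable_neg).aestronglyMeasurable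
        (by norm_num)
    refine hadd.trans ?_
    rw [hgneg]
    refine (add_le_add hfn hgn).trans_eq ?_
    rw [← add_mul, ENNReal.inv_two_add_inv_two, one_mul]

theorem IsSolution.mono {I J : Set ℝ} (hIJ : J ⊆ I) {y₀ y₁ u : ℝ → ℝ} {y yt : ℝ → ℝ → ℝ}
    (h : IsSolution I y₀ y₁ u y yt) : IsSolution J y₀ y₁ u y yt where
  absCont t ht := h.absCont t (hIJ ht)
  deriv_continuous t ht := ⟨(h.deriv_continuous t (hIJ ht)).1,
    (h.deriv_continuous t (hIJ ht)).2.mono_left (nhdsWithin_mono _ hIJ)⟩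
  velocity_continuous t ht := ⟨(h.velocity_continuous t (hIJ ht)).1,
    (h.velocity_continuous t (hIJ ht)).2.mono_left (nhdsWithin_mono _ hIJ)⟩
  hasDeriv t ht := (h.hasDeriv t (hIJ ht)).mono_left
    (nhdsWithin_mono _ (sdiff_subset_sdiff_left hIJ))
  dirichlet t ht := h.dirichlet t (hIJ ht)
  init_position := h.init_position
  init_velocity := h.init_velocity
  weak_form w hw hw0 t ht := h.weak_form w hw hw0 t (hIJ ht)

theorem IsLeftFlux.mono {I J : Set ℝ} (hIJ : J ⊆ I) {y yt : ℝ → ℝ → ℝ} {v : ℝ → ℝ}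
    (h : IsLeftFlux I y yt v) : IsLeftFlux J y yt v where
  integrable t ht := h.integrable t (hIJ ht)
  green w hw hw1 t ht := h.green w hw hw1 t (hIJ ht)

theorem ae_comp_add {Q : ℝ → Prop} (h : ∀ᵐ x, Q x) (c : ℝ) : ∀ᵐ x, Q (x + c) :=
  (measurePreserving_add_right volume c).quasiMeasurePreserving.ae h

theorem ae_comp_sub_left {Q : ℝ → Prop} (h : ∀ᵐ x, Q x) (c : ℝ) : ∀ᵐ x, Q (c - x) :=
  (Measure.measurePreserving_sub_left volume c).quasiMeasurePreserving.ae h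

theorem ae_ne (c : ℝ) : ∀ᵐ x : ℝ, x ≠ c := by simp [ae_iff, measure_singleton]

section Feasible

variable {y₀ y₁ p₀ p u v : ℝ → ℝ} {T : ℝ}

theorem IsDataProfile.wave_isSolution (hy : IsInitialData y₀ y₁) (hd : IsDataProfile y₀ y₁ p₀)
    (hp : IsProfile p) (hp₀ : ∀ τ ∈ Ico (-1 : ℝ) 1, p τ = p₀ τ) {I : Set ℝ}
    (hI : ∀ t ∈ I, 0 ≤ t) (hIc : I.OrdConnected) (hI0 : (0 : ℝ) ∈ I)
    (hu : ∀ᵐ t, t ∈ I → 0 < t → u t = p (t + 1) + p (t - 1)) :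
    IsSolution I y₀ y₁ u (wavePos p) (waveVel p) := by
  have e (x : ℝ) (hx : x ∈ Ioo (0 : ℝ) 1) : p x = p₀ x ∧ p (-x) = p₀ (-x) :=
    ⟨hp₀ x ⟨by linarith [hx.1], hx.2⟩, hp₀ (-x) ⟨by linarith [hx.2], by linarith [hx.1]⟩⟩
  have h1 := hd.add_reflect
  have h2 := hd.sub_reflect
  rw [ae_spaceMeasure_iff] at h1 h2
  refine _root_.wave_isSolution hp hI hy ?_ ?_ hu hIc hI0 <;> rw [ae_spaceMeasure_iff]
  · filter_upwards [h1] with x h hx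
    rw [(e x hx).1, (e x hx).2, h hx]
  · filter_upwards [h2] with x h hx
    rw [(e x hx).1, (e x hx).2, h hx]

/-- By uniqueness the state is the d'Alembert wave of the profile generated by `u`. At rest both
`p(T+x) + p(T-x)` and `p(T+x) - p(T-x)` vanish, hence so does `p` around `T`. -/
theorem IsFeasible.exists_profile (hy : IsInitialData y₀ y₁) (hd : IsDataProfile y₀ y₁ p₀)
    (hT : 0 < T) (h : IsFeasible T y₀ y₁ u v) :
    ∃ p, IsProfile p ∧ (∀ τ ∈ Ico (-1 : ℝ) 1, p τ = p₀ τ) ∧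
      (∀ᵐ t, t ∈ Ioo 0 T → u t = p (t + 1) + p (t - 1)) ∧
      ∀ᵐ τ, τ ∈ Ioo (T - 1) (T + 1) → p τ = 0 := by
  obtain ⟨huL, y, yt, hsol, -, hyT, hytT⟩ := h
  have hu2 : MemLp ((Ioo 0 T).indicator u) 2 volume :=
    (memLp_indicator_iff_restrict measurableSet_Ioo).2 huL
  obtain ⟨U, hU, hUu⟩ := hu2.aestronglyMeasurable
  obtain ⟨p, hp, hp₀, hpU⟩ := _root_.exists_profile hd.measurable hd.memLp hU.measurable
    (hu2.ae_eq hUu)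
  have hup : ∀ᵐ t, t ∈ Ioo 0 T → u t = p (t + 1) + p (t - 1) := by
    filter_upwards [hUu] with t ht htT
    rw [hpU t htT.1.le, ← ht, indicator_of_mem htT]
  refine ⟨p, hp, hp₀, hup, ?_⟩
  have hwave := hd.wave_isSolution hy hp hp₀ (u := u) (I := Icc 0 T) (fun t ht => ht.1)
    ordConnected_Icc ⟨le_rfl, hT.le⟩ (by
      filter_upwards [hup, ae_ne T] with t ht htT h1 h2
      exact ht ⟨h2, lt_of_le_of_ne h1.2 htT⟩)
  obtain ⟨hpos, hvel⟩ := hsol.unique hT hwave T ⟨hT.le, le_rfl⟩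
  have h1 : ∀ᵐ x ∂spaceMeasure, p (T + x) + p (T - x) = 0 := by
    have hz : ∀ x ∈ Icc (0 : ℝ) 1, wavePos p T x = (fun _ => (0 : ℝ)) x := fun x hx => by
      rw [← hpos x hx, hyT x hx]
    filter_upwards [deriv_wavePos hp T, deriv_ae_eq_spaceMeasure hz] with x a b
    rw [← a, b, deriv_const]
  have h2 : ∀ᵐ x ∂spaceMeasure, p (T + x) - p (T - x) = 0 := by
    filter_upwards [hvel, hytT] with x a b
    rw [b] at a
    exact a.symm
  rw [ae_spaceMeasure_iff] at h1 h2
  have h12 : ∀ᵐ x, x ∈ Ioo (0 : ℝ) 1 → p (T + x) = 0 ∧ p (T - x) = 0 := by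
    filter_upwards [h1, h2] with x a b hx
    have a := a hx
    have b := b hx
    constructor <;> linarith
  filter_upwards [ae_comp_add h12 (-T), ae_comp_sub_left h12 T, ae_ne T] with τ a b c hτ
  rcases lt_or_gt_of_ne c with hlt | hgt
  · have := (b ⟨by linarith, by linarith [hτ.1]⟩).2
    rwa [sub_sub_cancel] at this
  · have := (a ⟨by linarith, by linarith [hτ.2]⟩).1
    rwa [show T + (τ + -T) = τ by ring] at this

theorem isFeasible_of_profile (hy : IsInitialData y₀ y₁) (hd : IsDataProfile y₀ y₁ p₀)
    (hT : 0 < T) (hp : IsProfile p) (hp₀ : ∀ τ ∈ Ico (-1 : ℝ) 1, p τ = p₀ τ)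
    (hu : ∀ᵐ t, t ∈ Ioo 0 T → u t = p (t + 1) + p (t - 1)) (huL : MemLp u 2 (volume.restrict (Ioo 0 T)))
    (hend : ∀ τ ∈ Ioo (T - 1) (T + 1), p τ = 0) :
    IsFeasible T y₀ y₁ u (fun t => 2 * p t) := by
  refine ⟨huL, wavePos p, waveVel p, ?_, wave_isLeftFlux hp _, fun x hx => ?_, ?_⟩
  · refine hd.wave_isSolution hy hp hp₀ (fun t ht => ht.1) ordConnected_Icc ⟨le_rfl, hT.le⟩ ?_
    filter_upwards [hu, ae_ne T] with t ht htT h1 h2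
    exact ht ⟨h2, lt_of_le_of_ne h1.2 htT⟩
  · rw [wavePos, intervalIntegral.integral_congr_ae (g := fun _ => (0 : ℝ))]
    · simp
    · filter_upwards [ae_ne 1] with r hr1 hr
      rw [uIoc_of_le hx.1] at hr
      have : r < 1 := lt_of_le_of_ne (hr.2.trans hx.2) hr1
      rw [hend _ ⟨by linarith [hr.1], by linarith⟩, hend _ ⟨by linarith, by linarith [hr.1]⟩,
        add_zero]
  · rw [EventuallyEq, ae_spaceMeasure_iff]
    refine ae_of_all _ fun x hx => ?_
    rw [waveVel, hend _ ⟨by linarith [hx.1], by linarith [hx.2]⟩,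
      hend _ ⟨by linarith [hx.2], by linarith [hx.1]⟩, sub_zero, Pi.zero_apply]

theorem IsFeasibleInfinite.exists_profile (hy : IsInitialData y₀ y₁)
    (hd : IsDataProfile y₀ y₁ p₀) (h : IsFeasibleInfinite y₀ y₁ u v) :
    ∃ p, IsProfile p ∧ (∀ τ ∈ Ico (-1 : ℝ) 1, p τ = p₀ τ) ∧
      (∀ᵐ t, 0 < t → u t = p (t + 1) + p (t - 1)) ∧ ∀ᵐ t, 0 < t → v t = 2 * p t := by
  obtain ⟨huL, y, yt, hsol, hflux⟩ := h
  have hu2 : MemLp ((Ioi 0).indicator u) 2 volume :=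
    (memLp_indicator_iff_restrict measurableSet_Ioi).2 huL
  obtain ⟨U, hU, hUu⟩ := hu2.aestronglyMeasurable
  obtain ⟨p, hp, hp₀, hpU⟩ := _root_.exists_profile hd.measurable hd.memLp hU.measurable
    (hu2.ae_eq hUu)
  have hup : ∀ᵐ t, 0 < t → u t = p (t + 1) + p (t - 1) := by
    filter_upwards [hUu] with t ht htT
    rw [hpU t htT.le, ← ht, indicator_of_mem (show t ∈ Ioi (0 : ℝ) from htT)]
  refine ⟨p, hp, hp₀, hup, ?_⟩
  -- Uniqueness is available on bounded intervals, so the half-line is exhausted by countably many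
  -- of them.
  have hN : ∀ n : ℕ, ∀ᵐ t, t ∈ Ioo (0 : ℝ) (n + 1) → v t = 2 * p t := fun n => by
    have hwave := hd.wave_isSolution hy hp hp₀ (u := u) (I := Icc 0 ((n : ℝ) + 1))
      (fun t ht => ht.1) ordConnected_Icc ⟨le_rfl, by positivity⟩ (by
        filter_upwards [hup] with t ht _ h2 using ht h2)
    exact IsLeftFlux.unique (by positivity) (hsol.mono Icc_subset_Ici_self) hwave
      (hflux.mono Icc_subset_Ici_self) (wave_isLeftFlux hp _)
  filter_upwards [ae_all_iff.2 hN] with t ht ht0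
  obtain ⟨n, hn⟩ := exists_nat_ge t
  exact ht n ⟨ht0, by linarith⟩

theorem isFeasibleInfinite_of_profile (hy : IsInitialData y₀ y₁) (hd : IsDataProfile y₀ y₁ p₀)
    (hp : IsProfile p) (hp₀ : ∀ τ ∈ Ico (-1 : ℝ) 1, p τ = p₀ τ)
    (hu : ∀ᵐ t, 0 < t → u t = p (t + 1) + p (t - 1)) (huL : MemLp u 2 (volume.restrict (Ioi 0))) :
    IsFeasibleInfinite y₀ y₁ u (fun t => 2 * p t) := by
  refine ⟨huL, wavePos p, waveVel p, ?_, wave_isLeftFlux hp _⟩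
  refine hd.wave_isSolution hy hp hp₀ (fun t ht => ht) ordConnected_Ici self_mem_Ici ?_
  filter_upwards [hu] with t ht _ h2 using ht h2

end Feasible

section BlockProfile

variable {c : ℕ → ℝ} {p₀ : ℝ → ℝ}

theorem blockProfile_apply {k : ℕ} {τ : ℝ} (h : τ ∈ Ico (2 * (k : ℝ) - 1) (2 * k + 1)) :
    blockProfile c p₀ τ = c k * p₀ (τ - 2 * k) := glue_apply _ h

theorem blockProfile_initial (hc : c 0 = 1) {τ : ℝ} (h : τ ∈ Ico (-1 : ℝ) 1) :
    blockProfile c p₀ τ = p₀ τ := by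
  rw [blockProfile_apply (k := 0) (by simpa using h), hc]
  simp

/-- A two-term relation between the coefficients is inherited by the block profile. -/
theorem blockProfile_shift {c d : ℕ → ℝ} {a b e : ℝ} (h : ∀ k, a * c (k + 1) + b * c k = e * d k)
    {t : ℝ} (ht : 0 ≤ t) :
    a * blockProfile c p₀ (t + 1) + b * blockProfile c p₀ (t - 1) =
      e * blockProfile d p₀ (t - 1) := by
  obtain ⟨k, hk1, hk2⟩ := exists_mem_block (show -1 ≤ t - 1 by linarith)
  rw [blockProfile_apply (k := k) ⟨hk1, hk2⟩, blockProfile_apply (k := k) ⟨hk1, hk2⟩,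
    blockProfile_apply (k := k + 1) ⟨by push_cast; linarith, by push_cast; linarith⟩]
  push_cast
  rw [show t + 1 - 2 * ((k : ℝ) + 1) = t - 1 - 2 * k by ring]
  linear_combination p₀ (t - 1 - 2 * k) * h k

end BlockProfile

theorem intervalIntegrable_mul_of_memLp {f g : ℝ → ℝ} {a b R : ℝ}
    (hf : MemLp f 2 (volume.restrict (Iio R))) (hg : MemLp g 2 (volume.restrict (Iio R)))
    (ha : a < R) (hb : b < R) : IntervalIntegrable (fun x => f x * g x) volume a b := by
  rw [intervalIntegrable_iff]
  have hsub : uIoc a b ⊆ Iio R := fun x hx => lt_of_le_of_lt hx.2 (max_lt ha hb)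
  exact (hf.mono_measure (Measure.restrict_mono hsub le_rfl)).integrable_mul
    (hg.mono_measure (Measure.restrict_mono hsub le_rfl))

theorem IsProfile.intervalIntegrable_mul {p q : ℝ → ℝ} (hp : IsProfile p) (hq : IsProfile q)
    (a b : ℝ) : IntervalIntegrable (fun x => p x * q x) volume a b :=
  intervalIntegrable_mul_of_memLp (hp.memLp _) (hq.memLp _)
    (show a < max a b + 1 by linarith [le_max_left a b])
    (show b < max a b + 1 by linarith [le_max_right a b])

theorem IsProfile.comp_add {p : ℝ → ℝ} (hp : IsProfile p) (c : ℝ) :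
    IsProfile fun t => p (t + c) := by
  refine ⟨hp.measurable.comp (by fun_prop), fun R => ?_⟩
  rw [← memLp_indicator_iff_restrict measurableSet_Iio]
  refine (memLp_comp_add_right (hp.memLp_indicator (R + c)) c).ae_eq (ae_of_all _ fun x => ?_)
  simp [Set.indicator]

theorem IsProfile.add {p q : ℝ → ℝ} (hp : IsProfile p) (hq : IsProfile q) :
    IsProfile fun t => p t + q t :=
  ⟨hp.measurable.add hq.measurable, fun R => (hp.memLp R).add (hq.memLp R)⟩

theorem IsProfile.const_mul {p : ℝ → ℝ} (hp : IsProfile p) (c : ℝ) :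
    IsProfile fun t => c * p t :=
  ⟨hp.measurable.const_mul c, fun R => (hp.memLp R).const_mul c⟩

/-! ### The minimal norm problem with finite horizon -/

section FiniteHorizon

variable {y₀ y₁ p₀ u v : ℝ → ℝ} {n : ℕ} {T : ℝ}

/-- The optimal control of the problem of minimal `L²` norm with horizon `2 n`. -/
noncomputable def finiteControl (n : ℕ) (p₀ : ℝ → ℝ) (t : ℝ) : ℝ :=
  (n : ℝ)⁻¹ * blockProfile (fun k => (-1) ^ k) p₀ (t - 1)

theorem finiteControl_isProfile (h₀ : Measurable p₀) (h₀2 : MemLp p₀ 2 volume) :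
    IsProfile (finiteControl n p₀) :=
  ((blockProfile_isProfile _ h₀ h₀2).comp_add (-1)).const_mul _

theorem finiteControl_memLp (h₀ : Measurable p₀) (h₀2 : MemLp p₀ 2 volume) :
    MemLp (finiteControl n p₀) 2 (volume.restrict (Ioo 0 T)) :=
  (finiteControl_isProfile h₀ h₀2).memLp_of_subset Ioo_subset_Iio_self

theorem finiteControl_isFeasible (hn : 1 ≤ n) (hT : T = 2 * (n : ℝ)) (hy : IsInitialData y₀ y₁)
    (hd : IsDataProfile y₀ y₁ p₀) : ∃ v, IsFeasible T y₀ y₁ (finiteControl n p₀) v := by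
  have hn' : (0 : ℝ) < n := by exact_mod_cast hn
  refine ⟨_, isFeasible_of_profile hy hd (by linarith)
    -- The amplitude decreases linearly and vanishes at block `n`; consecutive coefficients add up
    -- to `(-1)^k / n`, the coefficient of the control.
    (p := blockProfile (fun k => (-1) ^ k * (1 - k / n)) p₀)
    (blockProfile_isProfile _ hd.measurable hd.memLp) (fun τ hτ => blockProfile_initial (by simp) hτ)
    (ae_of_all _ fun t ht => ?_) (finiteControl_memLp hd.measurable hd.memLp) fun τ hτ => ?_⟩
  · have := blockProfile_shift (p₀ := p₀) (c := fun k => (-1) ^ k * (1 - k / n))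
      (d := fun k => (-1) ^ k) (a := 1) (b := 1) (e := (n : ℝ)⁻¹) (fun k => by
        push_cast
        field_simp
        ring) ht.1.le
    rw [one_mul, one_mul] at this
    rw [this, finiteControl]
  · rw [hT] at hτ
    rw [blockProfile_apply (k := n) ⟨hτ.1.le, hτ.2⟩, div_self hn'.ne']
    simp

/-- All feasible controls have the same scalar product with the optimal control. -/
theorem IsFeasible.integral_mul_finiteControl (hT0 : 0 < T)
    (hy : IsInitialData y₀ y₁) (hd : IsDataProfile y₀ y₁ p₀) (h : IsFeasible T y₀ y₁ u v) :
    ∫ t in (0 : ℝ)..T, u t * finiteControl n p₀ t =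
      ∫ r in (-1 : ℝ)..1, p₀ r * finiteControl n p₀ (r + 1) := by
  obtain ⟨p, hp, hp₀, hu, hend⟩ := h.exists_profile hy hd hT0
  have hh := finiteControl_isProfile (n := n) hd.measurable hd.memLp
  have hh1 := hh.comp_add 1
  have hF := hp.intervalIntegrable_mul hh1
  -- The control changes sign under a shift by 2, so the contributions of `p(t+1)` and `p(t-1)`
  -- telescope. Only the data window `(-1,1)` and the terminal window remain, and `p` vanishes on
  -- the latter.
  have i1 : ∫ t in (0 : ℝ)..T, p (t + 1) * finiteControl n p₀ t =
      - ∫ r in (1 : ℝ)..(T + 1), p r * finiteControl n p₀ (r + 1) := by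
    have := intervalIntegral.integral_comp_add_right
      (fun r => p r * finiteControl n p₀ (r + 1)) (1 : ℝ) (a := 0) (b := T)
    rw [zero_add] at this
    rw [← this, ← intervalIntegral.integral_neg]
    refine intervalIntegral.integral_congr fun t ht => ?_
    rw [uIcc_of_le hT0.le] at ht
    have := blockProfile_shift (p₀ := p₀) (c := fun k => (-1) ^ k)
      (d := fun k => (-1) ^ k) (a := 1) (b := 0) (e := -1) (fun k => by ring) ht.1
    simp only [finiteControl]
    rw [show t + 1 + 1 - 1 = t + 1 by ring]
    linear_combination (p (t + 1) * (n : ℝ)⁻¹) * this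
  have i2 : ∫ t in (0 : ℝ)..T, p (t - 1) * finiteControl n p₀ t =
      ∫ r in (-1 : ℝ)..(T - 1), p r * finiteControl n p₀ (r + 1) := by
    have := intervalIntegral.integral_comp_sub_right
      (fun r => p r * finiteControl n p₀ (r + 1)) (1 : ℝ) (a := 0) (b := T)
    rw [zero_sub] at this
    rw [← this]
    simp only [sub_add_cancel]
  have i3 : ∫ t in (0 : ℝ)..T, u t * finiteControl n p₀ t =
      (∫ t in (0 : ℝ)..T, p (t + 1) * finiteControl n p₀ t) +
        ∫ t in (0 : ℝ)..T, p (t - 1) * finiteControl n p₀ t := by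
    rw [← intervalIntegral.integral_add ((hp.comp_add 1).intervalIntegrable_mul hh _ _)
      (hp.comp_sub_one.intervalIntegrable_mul hh _ _)]
    refine intervalIntegral.integral_congr_ae ?_
    filter_upwards [hu, ae_ne T] with t ht htT hI
    rw [uIoc_of_le hT0.le] at hI
    rw [ht ⟨hI.1, lt_of_le_of_ne hI.2 htT⟩, add_mul]
  have i4 : ∫ r in (T - 1)..(T + 1), p r * finiteControl n p₀ (r + 1) = 0 := by
    rw [intervalIntegral.integral_congr_ae (g := fun _ => (0 : ℝ)), intervalIntegral.integral_zero]
    filter_upwards [hend, ae_ne (T + 1)] with r hr hrT hI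
    rw [uIoc_of_le (by linarith)] at hI
    rw [hr ⟨hI.1, lt_of_le_of_ne hI.2 hrT⟩, zero_mul]
  have i5 : ∫ r in (-1 : ℝ)..1, p r * finiteControl n p₀ (r + 1) =
      ∫ r in (-1 : ℝ)..1, p₀ r * finiteControl n p₀ (r + 1) := by
    refine intervalIntegral.integral_congr_ae ?_
    filter_upwards [ae_ne 1] with r hr hI
    rw [uIoc_of_le (by norm_num)] at hI
    rw [hp₀ r ⟨hI.1.le, lt_of_le_of_ne hI.2 hr⟩]
  have a1 := intervalIntegral.integral_add_adjacent_intervals (hF (-1) 1) (hF 1 (T - 1))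
  have a2 := intervalIntegral.integral_add_adjacent_intervals (hF 1 (T - 1)) (hF (T - 1) (T + 1))
  rw [i3, i1, i2]
  linarith

theorem cost_one_eq (hT0 : 0 ≤ T) (hu : MemLp u 2 (volume.restrict (Ioo 0 T))) :
    cost 1 (Icc 0 T) v u = ENNReal.ofReal (∫ t in (0 : ℝ)..T, u t ^ 2) := by
  have hu' : MemLp u 2 (volume.restrict (Icc 0 T)) := by
    rwa [restrict_Ioo_eq_restrict_Icc] at hu
  rw [intervalIntegral.integral_of_le hT0, ← integral_Icc_eq_integral_Ioc,
    ofReal_integral_eq_lintegral_ofReal hu'.integrable_sq (ae_of_all _ fun t => sq_nonneg _), cost]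
  simp

theorem memLp_uIoc_of_Ioo (hT0 : 0 ≤ T) (hu : MemLp u 2 (volume.restrict (Ioo 0 T))) :
    MemLp u 2 (volume.restrict (uIoc 0 T)) := by
  rwa [restrict_Ioo_eq_restrict_Ioc, ← uIoc_of_le hT0] at hu

/-- Pythagoras: `finiteControl` is itself feasible, so its scalar product with `u` equals its own
squared norm and the difference is orthogonal to it. -/
theorem IsFeasible.integral_sq (hn : 1 ≤ n) (hT : T = 2 * (n : ℝ)) (hy : IsInitialData y₀ y₁)
    (hd : IsDataProfile y₀ y₁ p₀) (h : IsFeasible T y₀ y₁ u v) :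
    ∫ t in (0 : ℝ)..T, u t ^ 2 = (∫ t in (0 : ℝ)..T, finiteControl n p₀ t ^ 2) +
      ∫ t in (0 : ℝ)..T, (u t - finiteControl n p₀ t) ^ 2 := by
  have hT0 : 0 < T := by
    have : (1 : ℝ) ≤ n := by exact_mod_cast hn
    linarith
  obtain ⟨v', hv'⟩ := finiteControl_isFeasible hn hT hy hd
  have e1 := h.integral_mul_finiteControl (n := n) hT0 hy hd
  have e2 := hv'.integral_mul_finiteControl (n := n) hT0 hy hd
  have m1 := memLp_uIoc_of_Ioo hT0.le h.1
  have m2 := memLp_uIoc_of_Ioo hT0.le hv'.1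
  have j1 : IntervalIntegrable (fun t => u t ^ 2) volume 0 T :=
    intervalIntegrable_iff.2 m1.integrable_sq
  have j2 : IntervalIntegrable (fun t => finiteControl n p₀ t * finiteControl n p₀ t) volume 0 T :=
    intervalIntegrable_iff.2 (m2.integrable_mul m2)
  have j3 : IntervalIntegrable (fun t => u t * finiteControl n p₀ t) volume 0 T :=
    intervalIntegrable_iff.2 (m1.integrable_mul m2)
  have : ∫ t in (0 : ℝ)..T, (u t - finiteControl n p₀ t) ^ 2 = (∫ t in (0 : ℝ)..T, u t ^ 2) -
      2 * (∫ t in (0 : ℝ)..T, u t * finiteControl n p₀ t) +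
      ∫ t in (0 : ℝ)..T, finiteControl n p₀ t * finiteControl n p₀ t := by
    rw [← intervalIntegral.integral_const_mul, ← intervalIntegral.integral_sub j1 (j3.const_mul 2),
      ← intervalIntegral.integral_add (j1.sub (j3.const_mul 2)) j2]
    refine intervalIntegral.integral_congr fun t _ => ?_
    ring
  rw [this, e1, e2]
  simp only [pow_two (finiteControl n p₀ _), e2]
  ring

theorem finiteControl_isOptimal (hn : 1 ≤ n) (hT : T = 2 * (n : ℝ)) (hy : IsInitialData y₀ y₁)
    (hd : IsDataProfile y₀ y₁ p₀) : IsOptimalControl 1 T y₀ y₁ (finiteControl n p₀) := by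
  have hT0 : 0 ≤ T := by rw [hT]; positivity
  obtain ⟨v, hv⟩ := finiteControl_isFeasible hn hT hy hd
  refine ⟨v, hv, fun u' v' h' => ?_⟩
  rw [cost_one_eq hT0 hv.1, cost_one_eq hT0 h'.1, h'.integral_sq hn hT hy hd]
  refine ENNReal.ofReal_le_ofReal ?_
  linarith [intervalIntegral.integral_nonneg hT0
    (fun t _ => sq_nonneg (u' t - finiteControl n p₀ t)) (μ := volume)]

theorem IsOptimalControl.ae_eq_finiteControl (hn : 1 ≤ n) (hT : T = 2 * (n : ℝ))
    (hy : IsInitialData y₀ y₁) (hd : IsDataProfile y₀ y₁ p₀) (h : IsOptimalControl 1 T y₀ y₁ u) :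
    u =ᵐ[volume.restrict (Ioo 0 T)] finiteControl n p₀ := by
  have hT0 : 0 ≤ T := by rw [hT]; positivity
  obtain ⟨v', hv'⟩ := finiteControl_isFeasible hn hT hy hd
  obtain ⟨v, hv, hmin⟩ := h
  have hle := hmin _ _ hv'
  rw [cost_one_eq hT0 hv.1, cost_one_eq hT0 hv'.1, ENNReal.ofReal_le_ofReal_iff
    (intervalIntegral.integral_nonneg hT0 fun t _ => sq_nonneg _), hv.integral_sq hn hT hy hd] at hle
  have h0 := intervalIntegral.integral_nonneg hT0
    (fun t _ => sq_nonneg (u t - finiteControl n p₀ t)) (μ := volume)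
  have hz : ∫ t in (0 : ℝ)..T, (u t - finiteControl n p₀ t) ^ 2 = 0 := by linarith
  have hint : Integrable (fun t => (u t - finiteControl n p₀ t) ^ 2) (volume.restrict (Ioo 0 T)) :=
    (hv.1.sub hv'.1).integrable_sq
  rw [intervalIntegral.integral_of_le hT0, integral_Ioc_eq_integral_Ioo,
    integral_eq_zero_iff_of_nonneg (fun t => sq_nonneg _) hint] at hz
  filter_upwards [hz] with t ht
  exact sub_eq_zero.1 (pow_eq_zero_iff two_ne_zero |>.1 ht)

end FiniteHorizon

/-! ### The infinite horizon problem by completing the square -/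

section InfiniteHorizon

/-- The part of the running cost that depends on the control, along the profile `p`. -/
def stageCost (lam : ℝ) (p : ℝ → ℝ) (t : ℝ) : ℝ :=
  4 * (1 - lam) * p (t + 1) ^ 2 + lam * (p (t + 1) + p (t - 1)) ^ 2

/-- The part of the infinite horizon cost that depends on the control. -/
noncomputable def tailCost (lam : ℝ) (p : ℝ → ℝ) : ℝ≥0∞ :=
  ∫⁻ t in Ioi 0, ENNReal.ofReal (stageCost lam p t)

/-- `z` is the stable multiplier of the infinite horizon problem with weight `lam`. -/
structure IsStableMultiplier (lam z : ℝ) : Prop where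
  nonneg : 0 ≤ lam
  lt_one : lam < 1
  neg_one_lt : -1 < z
  nonpos : z ≤ 0
  -- Equivalently `λ z² + (4 - 2λ) z + λ = 0`, the characteristic equation of the Euler–Lagrange
  -- recursion for the block amplitudes.
  quadratic : lam * (1 - z) ^ 2 = -4 * z

variable {lam z : ℝ} {y₀ y₁ p₀ p q u v : ℝ → ℝ}

/-- Completing the square with the Riccati value `λ(1+z) p²`. The quadratic equation for `z` matches
the coefficients, and the first two terms telescope after integration. -/
theorem IsStableMultiplier.stageCost_eq (h : IsStableMultiplier lam z) (p : ℝ → ℝ) (t : ℝ) :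
    stageCost lam p t = lam * (1 + z) * p (t - 1) ^ 2 - lam * (1 + z) * p (t + 1) ^ 2 +
      (4 - 2 * lam + lam * z) * (p (t + 1) - z * p (t - 1)) ^ 2 := by
  unfold stageCost
  linear_combination (2 * p (t - 1) * p (t + 1) - p (t - 1) ^ 2 * z) * h.quadratic

theorem IsStableMultiplier.coeff_pos (h : IsStableMultiplier lam z) :
    0 < 4 - 2 * lam + lam * z := by
  nlinarith [h.nonneg, h.lt_one, h.neg_one_lt, mul_nonneg h.nonneg (by linarith [h.neg_one_lt] :
    (0 : ℝ) ≤ 1 + z)]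

theorem IsStableMultiplier.value_nonneg (h : IsStableMultiplier lam z) : 0 ≤ lam * (1 + z) :=
  mul_nonneg h.nonneg (by linarith [h.neg_one_lt])

theorem stageCost_nonneg (h0 : 0 ≤ lam) (h1 : lam ≤ 1) (p : ℝ → ℝ) (t : ℝ) :
    0 ≤ stageCost lam p t := by
  have : 0 ≤ 1 - lam := by linarith
  unfold stageCost
  positivity

theorem IsProfile.measurable_stageCost (hp : IsProfile p) : Measurable (stageCost lam p) := by
  have h1 : Measurable fun t => p (t + 1) := hp.measurable.comp (by fun_prop)
  have h2 : Measurable fun t => p (t - 1) := hp.measurable.comp (by fun_prop)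
  exact ((h1.pow_const 2).const_mul _).add (((h1.add h2).pow_const 2).const_mul _)

theorem IsProfile.intervalIntegrable_sq (hp : IsProfile p) (a b : ℝ) :
    IntervalIntegrable (fun t => p t ^ 2) volume a b := by
  simpa only [pow_two] using hp.intervalIntegrable_mul hp a b

theorem IsProfile.intervalIntegrable_stageCost (hp : IsProfile p) (a b : ℝ) :
    IntervalIntegrable (stageCost lam p) volume a b :=
  (((hp.comp_add 1).intervalIntegrable_sq a b).const_mul _).add
    ((((hp.comp_add 1).add hp.comp_sub_one).intervalIntegrable_sq a b).const_mul _)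

theorem IsProfile.deviation (hp : IsProfile p) (z : ℝ) :
    IsProfile fun t => p (t + 1) - z * p (t - 1) := by
  simpa only [neg_mul, ← sub_eq_add_neg] using (hp.comp_add 1).add (hp.comp_sub_one.const_mul (-z))

theorem IsStableMultiplier.integral_stageCost (h : IsStableMultiplier lam z) (hp : IsProfile p)
    (hp₀ : ∀ τ ∈ Ico (-1 : ℝ) 1, p τ = p₀ τ) (R : ℝ) :
    ∫ t in (0 : ℝ)..R, stageCost lam p t =
      lam * (1 + z) * (∫ r in (-1 : ℝ)..1, p₀ r ^ 2)
        - lam * (1 + z) * (∫ r in (R - 1)..(R + 1), p r ^ 2)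
        + (4 - 2 * lam + lam * z) * ∫ t in (0 : ℝ)..R, (p (t + 1) - z * p (t - 1)) ^ 2 := by
  have hi := hp.intervalIntegrable_sq
  have j1 := hp.comp_sub_one.intervalIntegrable_sq 0 R
  have j2 := (hp.comp_add 1).intervalIntegrable_sq 0 R
  have j3 := (hp.deviation z).intervalIntegrable_sq 0 R
  have e0 : ∫ r in (-1 : ℝ)..1, p r ^ 2 = ∫ r in (-1 : ℝ)..1, p₀ r ^ 2 := by
    refine intervalIntegral.integral_congr_ae ?_
    filter_upwards [ae_ne 1] with r hr hI
    rw [uIoc_of_le (by norm_num)] at hI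
    rw [hp₀ r ⟨hI.1.le, lt_of_le_of_ne hI.2 hr⟩]
  have e1 : ∫ t in (0 : ℝ)..R, p (t - 1) ^ 2 = ∫ r in (-1 : ℝ)..(R - 1), p r ^ 2 := by
    rw [intervalIntegral.integral_comp_sub_right (fun r => p r ^ 2), zero_sub]
  have e2 : ∫ t in (0 : ℝ)..R, p (t + 1) ^ 2 = ∫ r in (1 : ℝ)..(R + 1), p r ^ 2 := by
    rw [intervalIntegral.integral_comp_add_right (fun r => p r ^ 2), zero_add]
  simp only [h.stageCost_eq]
  rw [intervalIntegral.integral_add ((j1.const_mul _).sub (j2.const_mul _)) (j3.const_mul _),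
    intervalIntegral.integral_sub (j1.const_mul _) (j2.const_mul _),
    intervalIntegral.integral_const_mul, intervalIntegral.integral_const_mul,
    intervalIntegral.integral_const_mul, e1, e2, ← e0]
  have a1 := intervalIntegral.integral_add_adjacent_intervals (hi (-1) 1) (hi 1 (R - 1))
  have a2 := intervalIntegral.integral_add_adjacent_intervals (hi 1 (R - 1)) (hi (R - 1) (R + 1))
  linear_combination (lam * (1 + z)) * (a2 - a1)

theorem setLIntegral_stageCost (h0 : 0 ≤ lam) (h1 : lam ≤ 1) (hp : IsProfile p) {R : ℝ}
    (hR : 0 ≤ R) : ∫⁻ t in Ioc 0 R, ENNReal.ofReal (stageCost lam p t) =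
      ENNReal.ofReal (∫ t in (0 : ℝ)..R, stageCost lam p t) := by
  rw [intervalIntegral.integral_of_le hR, ofReal_integral_eq_lintegral_ofReal
    ((intervalIntegrable_iff_integrableOn_Ioc_of_le hR).1 (hp.intervalIntegrable_stageCost 0 R))
    (ae_of_all _ fun t => stageCost_nonneg h0 h1 p t)]

/-- For `λ < 1` the flux term alone is coercive in `p`. Decay at infinity thus comes from finite
cost, without a terminal constraint. -/
theorem IsProfile.integrableOn_sq_of_tailCost_lt_top (h0 : 0 ≤ lam) (h1 : lam < 1)
    (hp : IsProfile p) (hfin : tailCost lam p < ⊤) : IntegrableOn (fun t => p t ^ 2) (Ioi 1) := by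
  have hpos : 0 < 4 * (1 - lam) := by linarith
  have hm : Measurable fun t => p (t + 1) := hp.measurable.comp (by fun_prop)
  have h : IntegrableOn (fun t => 4 * (1 - lam) * p (t + 1) ^ 2) (Ioi 0) := by
    refine ⟨((hm.pow_const 2).const_mul _).aestronglyMeasurable, ?_⟩
    rw [hasFiniteIntegral_iff_ofReal (ae_of_all _ fun t => by positivity)]
    refine lt_of_le_of_lt (lintegral_mono fun t => ENNReal.ofReal_le_ofReal ?_) hfin
    have := mul_nonneg h0 (sq_nonneg (p (t + 1) + p (t - 1)))
    unfold stageCost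
    linarith
  have h2 : IntegrableOn (fun t => p (t + 1) ^ 2) (Ioi 0) := by
    have := h.const_mul (4 * (1 - lam))⁻¹
    refine this.congr (ae_of_all _ fun t => ?_)
    exact inv_mul_cancel_left₀ hpos.ne' _
  have h3 := ((measurePreserving_add_right volume (1 : ℝ)).integrableOn_comp_preimage
    (measurableEmbedding_addRight 1) (f := fun t => p t ^ 2) (s := Ioi 1))
  rw [← h3]
  simpa [Function.comp_def] using h2

/-- A window is a difference of two integrals with the same limit. It represents the value left at
time `R`. -/
theorem tendsto_integral_window {f : ℝ → ℝ} (hf : IntegrableOn f (Ioi 1))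
    (hi : ∀ a b : ℝ, IntervalIntegrable f volume a b) :
    Tendsto (fun R : ℝ => ∫ r in (R - 1)..(R + 1), f r) atTop (𝓝 0) := by
  have h1 := intervalIntegral_tendsto_integral_Ioi 1 hf
    (tendsto_atTop_add_const_right atTop (1 : ℝ) tendsto_id)
  have h2 := intervalIntegral_tendsto_integral_Ioi 1 hf
    (tendsto_atTop_add_const_right atTop (-1 : ℝ) tendsto_id)
  have h3 := h1.sub h2
  rw [sub_self] at h3
  refine h3.congr fun R => ?_
  have := intervalIntegral.integral_add_adjacent_intervals (hi 1 (R - 1)) (hi (R - 1) (R + 1))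
  simp only [id, ← sub_eq_add_neg]
  linarith

/-- A profile whose cost does not exceed the value `λ (1 + z) ∫ p₀²` follows the optimal
feedback. -/
theorem IsStableMultiplier.ae_eq_of_tailCost_le (h : IsStableMultiplier lam z) (hp : IsProfile p)
    (hp₀ : ∀ τ ∈ Ico (-1 : ℝ) 1, p τ = p₀ τ)
    (hle : tailCost lam p ≤ ENNReal.ofReal (lam * (1 + z) * ∫ r in (-1 : ℝ)..1, p₀ r ^ 2)) :
    ∀ᵐ t, 0 < t → p (t + 1) = z * p (t - 1) := by
  have hfin : tailCost lam p < ⊤ := lt_of_le_of_lt hle ENNReal.ofReal_lt_top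
  have hsq := hp.integrableOn_sq_of_tailCost_lt_top h.nonneg h.lt_one hfin
  have hwin := (tendsto_integral_window hsq hp.intervalIntegrable_sq).const_mul (lam * (1 + z))
  rw [mul_zero] at hwin
  have hV : 0 ≤ lam * (1 + z) * ∫ r in (-1 : ℝ)..1, p₀ r ^ 2 :=
    mul_nonneg h.value_nonneg (intervalIntegral.integral_nonneg (by norm_num) fun r _ => sq_nonneg _)
  have hdev (a b : ℝ) := (hp.deviation z).intervalIntegrable_sq a b
  -- The cost up to `R` is at most the value at time `0`; by the integrated identity that value
  -- cancels.
  have hbound : ∀ R, 0 ≤ R →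
      (4 - 2 * lam + lam * z) * (∫ t in (0 : ℝ)..R, (p (t + 1) - z * p (t - 1)) ^ 2) ≤
        lam * (1 + z) * ∫ r in (R - 1)..(R + 1), p r ^ 2 := fun R hR => by
    have h1 := (lintegral_mono_set (μ := volume) (f := fun t => ENNReal.ofReal (stageCost lam p t))
      (Ioc_subset_Ioi_self : Ioc 0 R ⊆ Ioi 0)).trans hle
    rw [setLIntegral_stageCost h.nonneg h.lt_one.le hp hR, ENNReal.ofReal_le_ofReal_iff hV,
      h.integral_stageCost hp hp₀ R] at h1
    linarith
  -- The squared deviation on `[0,S]` is bounded by that on `[0,R]` for `R ≥ S`, and the window term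
  -- tends to `0` as `R → ∞`.
  have hzero : ∀ S, 0 ≤ S → ∫ t in (0 : ℝ)..S, (p (t + 1) - z * p (t - 1)) ^ 2 = 0 :=
    fun S hS => by
      have hle0 : (4 - 2 * lam + lam * z) *
          (∫ t in (0 : ℝ)..S, (p (t + 1) - z * p (t - 1)) ^ 2) ≤ 0 := by
        refine ge_of_tendsto hwin ?_
        filter_upwards [eventually_ge_atTop S] with R hR
        refine le_trans (mul_le_mul_of_nonneg_left ?_ h.coeff_pos.le) (hbound R (hS.trans hR))
        rw [← intervalIntegral.integral_add_adjacent_intervals (hdev 0 S) (hdev S R)]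
        linarith [intervalIntegral.integral_nonneg hR
          (fun t _ => sq_nonneg (p (t + 1) - z * p (t - 1))) (μ := volume)]
      have hnn := intervalIntegral.integral_nonneg hS
        (fun t _ => sq_nonneg (p (t + 1) - z * p (t - 1))) (μ := volume)
      nlinarith [h.coeff_pos]
  have hN : ∀ n : ℕ, ∀ᵐ t, t ∈ Ioc (0 : ℝ) n → p (t + 1) = z * p (t - 1) := fun n => by
    have h1 := hzero n n.cast_nonneg
    rw [intervalIntegral.integral_of_le n.cast_nonneg, integral_eq_zero_iff_of_nonneg
      (fun t => sq_nonneg _) ((intervalIntegrable_iff_integrableOn_Ioc_of_le n.cast_nonneg).1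
        (hdev 0 n)), EventuallyEq, ae_restrict_iff' measurableSet_Ioc] at h1
    filter_upwards [h1] with t ht hI
    exact sub_eq_zero.1 (pow_eq_zero_iff two_ne_zero |>.1 (ht hI))
  filter_upwards [ae_all_iff.2 hN] with t ht ht0
  obtain ⟨n, hn⟩ := exists_nat_ge t
  exact ht n ⟨ht0, hn⟩

theorem ae_eq_blockProfile (hp₀ : ∀ τ ∈ Ico (-1 : ℝ) 1, p τ = p₀ τ)
    (hp : ∀ᵐ t, 0 < t → p (t + 1) = z * p (t - 1)) :
    ∀ᵐ τ, -1 < τ → p τ = blockProfile (fun k => z ^ k) p₀ τ := by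
  have key : ∀ k : ℕ, ∀ᵐ τ, τ ∈ Ico (2 * (k : ℝ) - 1) (2 * k + 1) →
      p τ = blockProfile (fun k => z ^ k) p₀ τ := by
    intro k
    induction k with
    | zero =>
      refine ae_of_all _ fun τ hτ => ?_
      have hτ' : τ ∈ Ico (-1 : ℝ) 1 := by simpa using hτ
      rw [hp₀ τ hτ', blockProfile_initial (by simp) hτ']
    | succ k ih =>
      have a1 := ae_comp_add hp (-1)
      have a2 := ae_comp_add ih (-2)
      filter_upwards [a1, a2, ae_ne 1] with τ h1 h2 h3 hτ
      push_cast at hτ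
      have hk : (0 : ℝ) ≤ k := k.cast_nonneg
      have hτ1 : 1 < τ := lt_of_le_of_ne (by linarith [hτ.1]) (Ne.symm h3)
      have h1 := h1 (by linarith)
      have h2 := h2 ⟨by linarith [hτ.1], by linarith [hτ.2]⟩
      rw [show τ + -1 + 1 = τ by ring, show τ + -1 - 1 = τ + -2 by ring, h2] at h1
      have h4 := blockProfile_shift (p₀ := p₀) (c := fun k => z ^ k)
        (d := fun k => z ^ k) (a := 1) (b := 0) (e := z) (fun k => by ring)
        (show 0 ≤ τ - 1 by linarith)
      rw [show τ - 1 + 1 = τ by ring, show τ - 1 - 1 = τ + -2 by ring] at h4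
      linarith
  filter_upwards [ae_all_iff.2 key] with τ h hτ
  obtain ⟨k, hk⟩ := exists_mem_block hτ.le
  exact h k hk

/-- Along the feedback the square vanishes, so the cost up to `R` is the initial value minus the
nonnegative value left at `R`. -/
theorem tailCost_blockProfile_le (h : IsStableMultiplier lam z) (h₀ : Measurable p₀)
    (h₀2 : MemLp p₀ 2 volume) :
    tailCost lam (blockProfile (fun k => z ^ k) p₀) ≤
      ENNReal.ofReal (lam * (1 + z) * ∫ r in (-1 : ℝ)..1, p₀ r ^ 2) := by
  have hp := blockProfile_isProfile (fun k => z ^ k) h₀ h₀2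
  have hcov : AECover (volume.restrict (Ioi (0 : ℝ))) atTop fun R : ℝ => Iic R :=
    aecover_Iic tendsto_id
  refine le_of_tendsto (hcov.lintegral_tendsto_of_countably_generated
    (f := fun t => ENNReal.ofReal (stageCost lam (blockProfile (fun k => z ^ k) p₀) t))
    (hp.measurable_stageCost.ennreal_ofReal.aemeasurable)) ?_
  filter_upwards [eventually_ge_atTop 0] with R hR
  rw [Measure.restrict_restrict measurableSet_Iic, inter_comm, Ioi_inter_Iic,
    setLIntegral_stageCost h.nonneg h.lt_one.le hp hR]
  refine ENNReal.ofReal_le_ofReal ?_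
  rw [h.integral_stageCost hp (fun τ hτ => blockProfile_initial (by simp) hτ)]
  have hdev : ∫ t in (0 : ℝ)..R, (blockProfile (fun k => z ^ k) p₀ (t + 1) -
      z * blockProfile (fun k => z ^ k) p₀ (t - 1)) ^ 2 = 0 := by
    rw [intervalIntegral.integral_congr (g := fun _ => (0 : ℝ)), intervalIntegral.integral_zero]
    intro t ht
    rw [uIcc_of_le hR] at ht
    have h4 := blockProfile_shift (p₀ := p₀) (c := fun k => z ^ k)
      (d := fun k => z ^ k) (a := 1) (b := 0) (e := z) (fun k => by ring) ht.1
    simp only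
    rw [show blockProfile (fun k => z ^ k) p₀ (t + 1) =
      z * blockProfile (fun k => z ^ k) p₀ (t - 1) by linarith]
    ring
  rw [hdev, mul_zero, add_zero]
  have := mul_nonneg h.value_nonneg (intervalIntegral.integral_nonneg
    (show R - 1 ≤ R + 1 by linarith)
    (fun r _ => sq_nonneg (blockProfile (fun k => z ^ k) p₀ r)) (μ := volume))
  linarith

/-- The cost splits into a part fixed by the initial data and `tailCost`. -/
theorem cost_eq_add_tailCost (h0 : 0 ≤ lam) (h1 : lam ≤ 1) (hp : IsProfile p)
    (hp₀ : ∀ τ ∈ Ico (-1 : ℝ) 1, p τ = p₀ τ)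
    (hu : ∀ᵐ t, 0 < t → u t = p (t + 1) + p (t - 1)) (hv : ∀ᵐ t, 0 < t → v t = 2 * p t) :
    cost lam (Ici 0) v u =
      (∫⁻ t in Ioc 0 1, ENNReal.ofReal (4 * (1 - lam) * p₀ t ^ 2)) + tailCost lam p := by
  have h1' : 0 ≤ 1 - lam := by linarith
  have m1 : Measurable fun t => ENNReal.ofReal (4 * (1 - lam) * p t ^ 2) :=
    ((hp.measurable.pow_const 2).const_mul _).ennreal_ofReal
  have m2 : Measurable fun t => ENNReal.ofReal (4 * (1 - lam) * p (t + 1) ^ 2) :=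
    m1.comp (by fun_prop)
  have e1 : cost lam (Ici 0) v u = (∫⁻ t in Ioi 0, ENNReal.ofReal (4 * (1 - lam) * p t ^ 2)) +
      ∫⁻ t in Ioi 0, ENNReal.ofReal (lam * (p (t + 1) + p (t - 1)) ^ 2) := by
    rw [cost, ← restrict_Ioi_eq_restrict_Ici, ← lintegral_add_left m1]
    refine lintegral_congr_ae ?_
    rw [EventuallyEq, ae_restrict_iff' measurableSet_Ioi]
    filter_upwards [hu, hv] with t a b ht
    rw [a ht, b ht, ← ENNReal.ofReal_add (by positivity) (by positivity)]
    congr 1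
    ring
  have e2 : tailCost lam p = (∫⁻ t in Ioi 0, ENNReal.ofReal (4 * (1 - lam) * p (t + 1) ^ 2)) +
      ∫⁻ t in Ioi 0, ENNReal.ofReal (lam * (p (t + 1) + p (t - 1)) ^ 2) := by
    rw [tailCost, ← lintegral_add_left m2]
    refine lintegral_congr fun t => ?_
    rw [stageCost, ENNReal.ofReal_add (by positivity) (by positivity)]
  -- The flux on `(0,1)` is fixed by the data; the flux after time `1` is shifted back by one to
  -- join the control term.
  have e3 : ∫⁻ t in Ioi 0, ENNReal.ofReal (4 * (1 - lam) * p (t + 1) ^ 2) =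
      ∫⁻ t in Ioi 1, ENNReal.ofReal (4 * (1 - lam) * p t ^ 2) := by
    have := (measurePreserving_add_right volume (1 : ℝ)).setLIntegral_comp_preimage
      (measurableSet_Ioi (a := (1 : ℝ))) m1
    simpa using this
  have e4 : ∫⁻ t in Ioi 0, ENNReal.ofReal (4 * (1 - lam) * p t ^ 2) =
      (∫⁻ t in Ioc 0 1, ENNReal.ofReal (4 * (1 - lam) * p₀ t ^ 2)) +
        ∫⁻ t in Ioi 1, ENNReal.ofReal (4 * (1 - lam) * p t ^ 2) := by
    rw [← Ioc_union_Ioi_eq_Ioi (zero_le_one' ℝ), lintegral_union measurableSet_Ioi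
      (Ioc_disjoint_Ioi le_rfl)]
    congr 1
    refine lintegral_congr_ae ?_
    rw [EventuallyEq, ae_restrict_iff' measurableSet_Ioc]
    filter_upwards [ae_ne 1] with t ht hI
    rw [hp₀ t ⟨by linarith [hI.1], lt_of_le_of_ne hI.2 ht⟩]
  rw [e1, e2, e3, e4, add_assoc]

/-- Finiteness permits cancelling this common part when two costs in `[0,∞]` are compared. -/
theorem initialCost_ne_top (h₀2 : MemLp p₀ 2 volume) (c : ℝ) :
    ∫⁻ t in Ioc (0 : ℝ) 1, ENNReal.ofReal (c * p₀ t ^ 2) ≠ ⊤ := by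
  have h : Integrable (fun t => c * p₀ t ^ 2) (volume.restrict (Ioc (0 : ℝ) 1)) :=
    (h₀2.mono_measure Measure.restrict_le_self).integrable_sq.const_mul c
  exact ((lintegral_mono fun t => Real.ofReal_le_enorm _).trans_lt h.2).ne

/-- The optimal control of the infinite horizon problem. -/
noncomputable def infiniteControl (z : ℝ) (p₀ : ℝ → ℝ) (t : ℝ) : ℝ :=
  (1 + z) * blockProfile (fun k => z ^ k) p₀ (t - 1)

theorem blockProfile_add_eq_infiniteControl {t : ℝ} (ht : 0 ≤ t) :
    infiniteControl z p₀ t = blockProfile (fun k => z ^ k) p₀ (t + 1) +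
      blockProfile (fun k => z ^ k) p₀ (t - 1) := by
  have := blockProfile_shift (p₀ := p₀) (c := fun k => z ^ k)
    (d := fun k => z ^ k) (a := 1) (b := 1) (e := 1 + z) (fun k => by ring) ht
  rw [infiniteControl, ← this, one_mul, one_mul]

/-- Finite cost already gives square integrability of the profile, so no geometric series has to be
summed. -/
theorem infiniteControl_memLp (h : IsStableMultiplier lam z) (h₀ : Measurable p₀)
    (h₀2 : MemLp p₀ 2 volume) : MemLp (infiniteControl z p₀) 2 (volume.restrict (Ioi 0)) := by
  have hp := blockProfile_isProfile (fun k => z ^ k) h₀ h₀2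
  have h1 := hp.integrableOn_sq_of_tailCost_lt_top h.nonneg h.lt_one
    ((tailCost_blockProfile_le h h₀ h₀2).trans_lt ENNReal.ofReal_lt_top)
  have h2 : IntegrableOn (fun t => blockProfile (fun k => z ^ k) p₀ t ^ 2) (Ioc (-1) 1) :=
    (intervalIntegrable_iff_integrableOn_Ioc_of_le (by norm_num)).1
      (hp.intervalIntegrable_sq (-1) 1)
  have h3 := h2.union h1
  rw [Ioc_union_Ioi_eq_Ioi (by norm_num)] at h3
  have h4 : MemLp (blockProfile (fun k => z ^ k) p₀) 2 (volume.restrict (Ioi (-1))) :=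
    (memLp_two_iff_integrable_sq hp.measurable.aestronglyMeasurable).2 h3
  have h5 := memLp_comp_sub_right ((memLp_indicator_iff_restrict measurableSet_Ioi).2 h4) 1
  refine MemLp.const_mul ?_ _
  rw [← memLp_indicator_iff_restrict measurableSet_Ioi]
  refine h5.ae_eq (ae_of_all _ fun t => ?_)
  simp [Set.indicator]

theorem infiniteControl_isFeasible (h : IsStableMultiplier lam z) (hy : IsInitialData y₀ y₁)
    (hd : IsDataProfile y₀ y₁ p₀) : IsFeasibleInfinite y₀ y₁ (infiniteControl z p₀)
      (fun t => 2 * blockProfile (fun k => z ^ k) p₀ t) :=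
  isFeasibleInfinite_of_profile hy hd (blockProfile_isProfile _ hd.measurable hd.memLp)
    (fun τ hτ => blockProfile_initial (by simp) hτ)
    (ae_of_all _ fun t ht => blockProfile_add_eq_infiniteControl ht.le)
    (infiniteControl_memLp h hd.measurable hd.memLp)

/-- A control that is at least as good as `infiniteControl` agrees with it. -/
theorem IsFeasibleInfinite.eq_of_cost_le (h : IsStableMultiplier lam z)
    (hy : IsInitialData y₀ y₁) (hd : IsDataProfile y₀ y₁ p₀) (hf : IsFeasibleInfinite y₀ y₁ u v)
    (hle : cost lam (Ici 0) v u ≤ cost lam (Ici 0)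
      (fun t => 2 * blockProfile (fun k => z ^ k) p₀ t) (infiniteControl z p₀)) :
    u =ᵐ[volume.restrict (Ioi 0)] infiniteControl z p₀ ∧
      cost lam (Ici 0) v u = cost lam (Ici 0)
        (fun t => 2 * blockProfile (fun k => z ^ k) p₀ t) (infiniteControl z p₀) := by
  obtain ⟨p, hp, hp₀, hu, hv⟩ := hf.exists_profile hy hd
  have hb := blockProfile_isProfile (fun k => z ^ k) hd.measurable hd.memLp
  have c1 := cost_eq_add_tailCost h.nonneg h.lt_one.le hp hp₀ hu hv
  have c2 := cost_eq_add_tailCost (u := infiniteControl z p₀) (p₀ := p₀) h.nonneg h.lt_one.le hb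
    (fun τ hτ => blockProfile_initial (by simp) hτ)
    (ae_of_all _ fun t ht => blockProfile_add_eq_infiniteControl ht.le)
    (ae_of_all _ fun t _ => rfl)
  rw [c1, c2] at hle
  have htail := (ENNReal.add_le_add_iff_left (initialCost_ne_top hd.memLp _)).1 hle
  have hopt := h.ae_eq_of_tailCost_le hp hp₀
    (htail.trans (tailCost_blockProfile_le h hd.measurable hd.memLp))
  have hpb := ae_eq_blockProfile hp₀ hopt
  have g1 := ae_comp_add hpb 1
  have g2 : ∀ᵐ t, -1 < t - 1 → p (t - 1) = blockProfile (fun k => z ^ k) p₀ (t - 1) :=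
    ae_comp_add hpb (-1)
  constructor
  · rw [EventuallyEq, ae_restrict_iff' measurableSet_Ioi]
    filter_upwards [hu, g1, g2] with t a b c ht
    have ht' : (0 : ℝ) < t := ht
    rw [a ht, blockProfile_add_eq_infiniteControl ht'.le, b (by linarith),
      c (by linarith)]
  · rw [c1, c2]
    congr 1
    refine lintegral_congr_ae ?_
    rw [EventuallyEq, ae_restrict_iff' measurableSet_Ioi]
    filter_upwards [g1, g2] with t b c ht
    have ht' : (0 : ℝ) < t := ht
    rw [stageCost, stageCost, b (by linarith), c (by linarith)]

theorem infiniteControl_isOptimal (h : IsStableMultiplier lam z) (hy : IsInitialData y₀ y₁)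
    (hd : IsDataProfile y₀ y₁ p₀) :
    IsOptimalControlInfinite lam y₀ y₁ (infiniteControl z p₀) := by
  refine ⟨_, infiniteControl_isFeasible h hy hd, fun u' v' h' => ?_⟩
  by_contra! hlt
  exact hlt.ne (h'.eq_of_cost_le h hy hd hlt.le).2

theorem IsOptimalControlInfinite.ae_eq_infiniteControl (h : IsStableMultiplier lam z)
    (hy : IsInitialData y₀ y₁) (hd : IsDataProfile y₀ y₁ p₀)
    (hu : IsOptimalControlInfinite lam y₀ y₁ u) :
    u =ᵐ[volume.restrict (Ioi 0)] infiniteControl z p₀ := by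
  obtain ⟨v, hv, hmin⟩ := hu
  exact (hv.eq_of_cost_le h hy hd (hmin _ _ (infiniteControl_isFeasible h hy hd))).1

end InfiniteHorizon

/-! ### The weight matched to the horizon -/

section Parameter

variable {lam : ℝ} {n : ℕ} {T : ℝ}

/-- With `r = √(1-λ)` the numerator is `(r-1)(r+1)` and the denominator `(r+1)²`. In terms of `r`
the matching condition becomes linear. -/
theorem zParam_eq (h : lam ≤ 1) :
    zParam lam = (Real.sqrt (1 - lam) - 1) / (Real.sqrt (1 - lam) + 1) := by
  have hr := Real.sqrt_nonneg (1 - lam)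
  have hsq := Real.sq_sqrt (show 0 ≤ 1 - lam by linarith)
  have e : lam = 1 - Real.sqrt (1 - lam) ^ 2 := by linarith
  unfold zParam
  rw [div_eq_div_iff (by nlinarith) (by linarith)]
  generalize Real.sqrt (1 - lam) = r at *
  subst e
  ring

theorem sqrt_eq_of_zParam_eq (hn : 1 ≤ n) (hT : T = 2 * (n : ℝ)) (h : lam ≤ 1)
    (hz : zParam lam = 2 / T - 1) : Real.sqrt (1 - lam) = (2 * n - 1 : ℝ)⁻¹ := by
  have hn' : (1 : ℝ) ≤ n := by exact_mod_cast hn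
  have hr := Real.sqrt_nonneg (1 - lam)
  rw [zParam_eq h, hT] at hz
  have h1 : (0 : ℝ) < n := by linarith
  field_simp at hz
  refine eq_inv_of_mul_eq_one_left ?_
  linarith

theorem lam_eq_of_zParam_eq (hn : 1 ≤ n) (hT : T = 2 * (n : ℝ)) (h : lam ≤ 1)
    (hz : zParam lam = 2 / T - 1) : lam = 1 - ((2 * n - 1 : ℝ)⁻¹) ^ 2 := by
  rw [← sqrt_eq_of_zParam_eq hn hT h hz, Real.sq_sqrt (by linarith)]
  ring

theorem existsUnique_zParam_eq (hn : 1 ≤ n) (hT : T = 2 * (n : ℝ)) :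
    ∃! lam : ℝ, lam ∈ Icc (0 : ℝ) 1 ∧ zParam lam = 2 / T - 1 := by
  have hn' : (1 : ℝ) ≤ n := by exact_mod_cast hn
  have hpos : (0 : ℝ) < 2 * n - 1 := by linarith
  have hinv : (0 : ℝ) < (2 * n - 1 : ℝ)⁻¹ := inv_pos.2 hpos
  have hinv1 : (2 * n - 1 : ℝ)⁻¹ ≤ 1 := inv_le_one_of_one_le₀ (by linarith)
  refine ⟨1 - ((2 * n - 1 : ℝ)⁻¹) ^ 2, ⟨⟨by nlinarith, by nlinarith⟩, ?_⟩, fun lam hl =>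
    lam_eq_of_zParam_eq hn hT hl.1.2 hl.2⟩
  rw [zParam_eq (by nlinarith), sub_sub_cancel, Real.sqrt_sq hinv.le, hT]
  have h1 : (0 : ℝ) < n := by linarith
  have h2 : (2 * n - 1 : ℝ)⁻¹ + 1 ≠ 0 := by positivity
  rw [div_eq_iff h2]
  field_simp
  ring

theorem isStableMultiplier_zParam (hn : 1 ≤ n) (hT : T = 2 * (n : ℝ)) (hl : lam ∈ Icc (0 : ℝ) 1)
    (hz : zParam lam = 2 / T - 1) : IsStableMultiplier lam (zParam lam) := by
  have hn' : (1 : ℝ) ≤ n := by exact_mod_cast hn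
  have hpos : (0 : ℝ) < 2 * n - 1 := by linarith
  have hinv : (0 : ℝ) < (2 * n - 1 : ℝ)⁻¹ := inv_pos.2 hpos
  have hlam := lam_eq_of_zParam_eq hn hT hl.2 hz
  have h1 : (0 : ℝ) < n := by linarith
  have hz' : zParam lam = (n : ℝ)⁻¹ - 1 := by
    rw [hz, hT]
    field_simp
  have hni : (0 : ℝ) < (n : ℝ)⁻¹ := inv_pos.2 h1
  have hni1 : (n : ℝ)⁻¹ ≤ 1 := inv_le_one_of_one_le₀ hn'
  refine ⟨hl.1, by nlinarith, by linarith, by linarith, ?_⟩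
  rw [hz', hlam]
  field_simp
  ring

theorem lam_pos_iff (hn : 1 ≤ n) (hT : T = 2 * (n : ℝ)) (hl : lam ∈ Icc (0 : ℝ) 1)
    (hz : zParam lam = 2 / T - 1) : 0 < lam ↔ 2 < T := by
  have hn' : (1 : ℝ) ≤ n := by exact_mod_cast hn
  have hpos : (0 : ℝ) < 2 * n - 1 := by linarith
  have hinv : (0 : ℝ) < (2 * n - 1 : ℝ)⁻¹ := inv_pos.2 hpos
  rw [lam_eq_of_zParam_eq hn hT hl.2 hz, hT, sub_pos, sq_lt_one_iff₀ hinv.le,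
    inv_lt_one₀ hpos]
  constructor <;> intro h <;> linarith

end Parameter

/-! ### Comparison of the two controls -/

/-- On block `k` both controls are multiples of the same translate of `p₀`, and `z ≤ 0` gives `z^k =
(-1)^k |z|^k`. The common factor `1/n = 1 + z` comes out. -/
theorem L2norm_finiteControl_sub_infiniteControl_le {n : ℕ} {z : ℝ} (hz : z ≤ 0)
    (hzn : 1 + z = (n : ℝ)⁻¹) {p₀ : ℝ → ℝ} (h₀ : Measurable p₀) (k : ℕ) :
    L2norm (2 * (k : ℝ)) (2 * (k : ℝ) + 2)
        (fun t => finiteControl n p₀ t - infiniteControl z p₀ t) ≤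
      ENNReal.ofReal (|1 - |z| ^ k| * (n : ℝ)⁻¹) * eLpNorm p₀ 2 volume := by
  have hcoef : |(n : ℝ)⁻¹ * ((-1) ^ k - z ^ k)| = |1 - |z| ^ k| * (n : ℝ)⁻¹ := by
    have : z ^ k = (-1) ^ k * |z| ^ k := by
      rw [← mul_pow, abs_of_nonpos hz]
      ring
    rw [this, show (n : ℝ)⁻¹ * ((-1) ^ k - (-1) ^ k * |z| ^ k) =
      (-1) ^ k * ((1 - |z| ^ k) * (n : ℝ)⁻¹) by ring, abs_mul, abs_pow, abs_neg, abs_one, one_pow,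
      one_mul, abs_mul, abs_of_nonneg (show 0 ≤ (n : ℝ)⁻¹ by positivity)]
  have hshift : eLpNorm (fun t => p₀ (t - (1 + 2 * k))) 2 volume = eLpNorm p₀ 2 volume :=
    eLpNorm_comp_measurePreserving h₀.aestronglyMeasurable
      (measurePreserving_sub_right volume (1 + 2 * (k : ℝ)))
  have hcongr : L2norm (2 * (k : ℝ)) (2 * (k : ℝ) + 2)
      (fun t => finiteControl n p₀ t - infiniteControl z p₀ t) =
      eLpNorm (((n : ℝ)⁻¹ * ((-1) ^ k - z ^ k)) • fun t => p₀ (t - (1 + 2 * k))) 2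
        (volume.restrict (Ioo (2 * (k : ℝ)) (2 * k + 2))) := by
    refine eLpNorm_congr_ae ?_
    rw [EventuallyEq, ae_restrict_iff' measurableSet_Ioo]
    refine ae_of_all _ fun t ht => ?_
    have hI : t - 1 ∈ Ico (2 * (k : ℝ) - 1) (2 * k + 1) := ⟨by linarith [ht.1], by linarith [ht.2]⟩
    rw [finiteControl, infiniteControl, blockProfile_apply hI, blockProfile_apply hI, hzn,
      Pi.smul_apply, smul_eq_mul, sub_sub]
    ring
  rw [hcongr, eLpNorm_const_smul, ← hcoef, ← Real.enorm_eq_ofReal_abs, ← hshift]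
  gcongr
  exact Measure.restrict_le_self

theorem theorem2 (n : ℕ) (hn : 1 ≤ n) (T : ℝ) (hT : T = 2 * (n : ℝ)) :
    (∃! lam : ℝ, lam ∈ Icc (0 : ℝ) 1 ∧ zParam lam = 2 / T - 1) ∧
    ∀ lam ∈ Icc (0 : ℝ) 1, zParam lam = 2 / T - 1 →
      lam < 1 ∧ (0 < lam ↔ 2 < T) ∧
      ∀ y₀ y₁ : ℝ → ℝ, IsInitialData y₀ y₁ →
        -- existence and uniqueness of the two optimal controls
        (∃ u, IsOptimalControl 1 T y₀ y₁ u) ∧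
        (∀ u u', IsOptimalControl 1 T y₀ y₁ u → IsOptimalControl 1 T y₀ y₁ u' →
          u =ᵐ[volume.restrict (Ioo 0 T)] u') ∧
        (∃ u, IsOptimalControlInfinite lam y₀ y₁ u) ∧
        (∀ u u', IsOptimalControlInfinite lam y₀ y₁ u → IsOptimalControlInfinite lam y₀ y₁ u' →
          u =ᵐ[volume.restrict (Ioi 0)] u') ∧
        -- comparison of the two optimal controls
        ∀ uT uInf, IsOptimalControl 1 T y₀ y₁ uT → IsOptimalControlInfinite lam y₀ y₁ uInf →
          uT =ᵐ[volume.restrict (Ioo 0 2)] uInf ∧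
          ∀ k : ℕ, k < n →
            L2norm (2 * (k : ℝ)) (2 * (k : ℝ) + 2) (fun t => uT t - uInf t) ≤
              ENNReal.ofReal (|1 - |zParam lam| ^ k| * (2 / T)) *
                (L2norm 0 1 (deriv y₀) + L2norm 0 1 y₁) := by
  refine ⟨existsUnique_zParam_eq hn hT, fun lam hl hz => ?_⟩
  have hS := isStableMultiplier_zParam hn hT hl hz
  refine ⟨hS.lt_one, lam_pos_iff hn hT hl hz, fun y₀ y₁ hy => ?_⟩
  obtain ⟨p₀, hd, hnorm⟩ := hy.exists_dataProfile
  have hn0 : (0 : ℝ) < n := by exact_mod_cast hn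
  have hT2 : 2 / T = (n : ℝ)⁻¹ := by
    rw [hT]
    field_simp
  have hzn : 1 + zParam lam = (n : ℝ)⁻¹ := by rw [hz, ← hT2]; ring
  refine ⟨⟨_, finiteControl_isOptimal hn hT hy hd⟩, fun u u' hu hu' =>
    (hu.ae_eq_finiteControl hn hT hy hd).trans (hu'.ae_eq_finiteControl hn hT hy hd).symm,
    ⟨_, infiniteControl_isOptimal hS hy hd⟩, fun u u' hu hu' =>
    (hu.ae_eq_infiniteControl hS hy hd).trans (hu'.ae_eq_infiniteControl hS hy hd).symm,
    fun uT uInf huT huInf => ?_⟩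
  have hblock : ∀ k : ℕ, k < n →
      uT =ᵐ[volume.restrict (Ioo (2 * (k : ℝ)) (2 * k + 2))] finiteControl n p₀ ∧
      uInf =ᵐ[volume.restrict (Ioo (2 * (k : ℝ)) (2 * k + 2))] infiniteControl (zParam lam) p₀ := by
    intro k hk
    have hk1 : (k : ℝ) + 1 ≤ n := by exact_mod_cast hk
    have hk0 : (0 : ℝ) ≤ k := k.cast_nonneg
    refine ⟨ae_restrict_of_ae_restrict_of_subset ?_ (huT.ae_eq_finiteControl hn hT hy hd),
      ae_restrict_of_ae_restrict_of_subset ?_ (huInf.ae_eq_infiniteControl hS hy hd)⟩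
    · exact Ioo_subset_Ioo (by linarith) (by rw [hT]; linarith)
    · exact fun t ht => lt_of_le_of_lt (by linarith) ht.1
  constructor
  · have h0 := hblock 0 hn
    simp only [Nat.cast_zero, mul_zero, zero_add] at h0
    refine h0.1.trans (EventuallyEq.trans ?_ h0.2.symm)
    rw [EventuallyEq, ae_restrict_iff' measurableSet_Ioo]
    refine ae_of_all _ fun t ht => ?_
    have hI : t - 1 ∈ Ico (-1 : ℝ) 1 := ⟨by linarith [ht.1], by linarith [ht.2]⟩
    -- On the first block both controls equal `p₀(t-1) / n`, because `1 + z = 1/n`.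
    rw [finiteControl, infiniteControl, hzn, blockProfile_initial (by simp) hI,
      blockProfile_initial (by simp) hI]
  · intro k hk
    obtain ⟨e1, e2⟩ := hblock k hk
    rw [hT2]
    refine le_trans (le_of_eq (eLpNorm_congr_ae (e1.sub e2))) ?_
    refine (L2norm_finiteControl_sub_infiniteControl_le hS.nonpos hzn hd.measurable k).trans ?_
    gcongr
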